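/- Let $\mathbb{K}$ be $\mathbb{R}$ or $\mathbb{C}$; all Banach spaces are over $\mathbb{K}$. A \emph{Banach category} is a category enriched in Banach spaces and linear contractions: each $\mathrm{Hom}(a,b)$ is a Banach space, composition is bilinear with $\|g f\|\le\|g\|\,\|f\|$, and $\|\mathrm{id}\|\le 1$. A functor between Banach categories is \emph{contractive} if it acts on each hom-space as a linear contraction; it is \emph{cocontinuous} if it moreover preserves all small (weighted, i.e. enriched) colimits. For Banach categories $\mathcal{A},\mathcal{B}$ let $\mathrm{BanModCat}(\mathcal{A},\mathcal{B})$ be the category of cocontinuous contractive functors $\mathcal{A}\to\mathcal{B}$, with the Banach spaces of uniformly bounded natural transformations, under $\|\tau\|=\sup_a\|\tau_a\|$, as hom-spaces. (These may be large.) An \emph{equivalence} of Banach categories is a contractive functor $F$ that admits a contractive functor $G$ in the other direction and natural isometric isomorphisms $GF\cong\mathrm{id}$, $FG\cong\mathrm{id}$; it restricts to an equivalence of the subcategories of contractions. For a set $X$ let $\mathrm{Bundle}(X)$ be the Banach category whose objects are families $\xi=(\xi_x)_{x\in X}$ of Banach spaces and whose hom-spaces are $\mathrm{Hom}(\xi,\zeta)=\{(f_x)_{x\in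 X} : f_x\colon\xi_x\to\zeta_x \text{ bounded linear},\ \|f\|=\sup_x\|f_x\|<\infty\}$. For $x\in X$ let $\delta_x\in\mathrm{Bundle}(X)$ have fibre $\mathbb{K}$ over $x$ and $0$ elsewhere. \textbf{Theorem.} (1) For all sets $X,Y$, the functor that sends a cocontinuous functor $T$ to its matrix $T_x^y=(T\delta_x)_y$, and a natural transformation $\tau$ to the family $((\tau_{\delta_x})_y)_{(x,y)}$, is an equivalence of Banach categories $$\mathrm{BanModCat}(\mathrm{Bundle}(X),\mathrm{Bundle}(Y))\simeq\mathrm{Bundle}(X\times Y).$$ (2) For all sets $X,Y,Z$, all cocontinuous functors $T\colon\mathrm{Bundle}(X)\to\mathrm{Bundle}(Y)$ and $S\colon\mathrm{Bundle}(Y)\to\mathrm{Bundle}(Z)$, and all $x\in X$, $z\in Z$, there is an isometric isomorphism, natural in $S$ and $T$, $$(ST)_x^z\;\cong\;\sum_{y\in Y}S_y^z\otimes T_x^y,$$ where $\otimes$ is the projective tensor product of Banach spaces and $\sum_{y\in Y}$ is the $\ell_1$-direct sum (the families $(b_y)_{y\in Y}$ with $\sum_y\|b_y\|<\infty$). -/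

import Mathlib

open CategoryTheory
open scoped ENNReal TensorProduct

universe w w₁ w₂ w₃ v v₁ v₂ v₃ u

noncomputable section

/-! ## Banach categories

A Banach category over `𝕜` is a category enriched in Banach spaces and linear contractions: every
hom-set is a Banach space, composition is bilinear with `‖f ≫ g‖ ≤ ‖f‖ * ‖g‖`, and identities are
contractions.  It is split into the part that does not mention the scalars (`NormedCategory`) and
the part that does (`BanachCategory`). -/

/-- A category whose hom-sets are complete normed groups, with biadditive contractive
composition. -/
class NormedCategory (A : Type w) extends Category.{v} A where
  homNormed : ∀ a b : A, NormedAddCommGroup (a ⟶ b)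
  homComplete : ∀ a b : A, CompleteSpace (a ⟶ b)
  add_comp : ∀ {a b c : A} (f f' : a ⟶ b) (g : b ⟶ c), (f + f') ≫ g = f ≫ g + f' ≫ g
  comp_add : ∀ {a b c : A} (f : a ⟶ b) (g g' : b ⟶ c), f ≫ (g + g') = f ≫ g + f ≫ g'
  norm_comp_le : ∀ {a b c : A} (f : a ⟶ b) (g : b ⟶ c), ‖f ≫ g‖ ≤ ‖f‖ * ‖g‖
  norm_id_le : ∀ a : A, ‖𝟙 a‖ ≤ 1

attribute [reducible] NormedCategory.homNormed
attribute [instance] NormedCategory.homNormed NormedCategory.homComplete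

/-- A Banach category over `𝕜`: the hom-sets are moreover Banach spaces over `𝕜`, and composition
is bilinear. -/
class BanachCategory (𝕜 : Type u) [RCLike 𝕜] (A : Type w) [NormedCategory.{w, v} A] where
  homSpace : ∀ a b : A, NormedSpace 𝕜 (a ⟶ b)
  smul_comp : ∀ {a b c : A} (r : 𝕜) (f : a ⟶ b) (g : b ⟶ c), (r • f) ≫ g = r • (f ≫ g)
  comp_smul : ∀ {a b c : A} (r : 𝕜) (f : a ⟶ b) (g : b ⟶ c), f ≫ (r • g) = r • (f ≫ g)

attribute [reducible] BanachCategory.homSpace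
attribute [instance] BanachCategory.homSpace

/-- A contractive (that is, enriched) functor: on hom-spaces it is a linear contraction. -/
structure ContractiveFunctor (𝕜 : Type u) [RCLike 𝕜]
    (A : Type w₁) [NormedCategory.{w₁, v₁} A] [BanachCategory 𝕜 A]
    (B : Type w₂) [NormedCategory.{w₂, v₂} B] [BanachCategory 𝕜 B]
    extends CategoryTheory.Functor A B where
  map_add : ∀ {a b : A} (f g : a ⟶ b), map (f + g) = map f + map g
  map_smul : ∀ {a b : A} (r : 𝕜) (f : a ⟶ b), map (r • f) = r • map f
  norm_map_le : ∀ {a b : A} (f : a ⟶ b), ‖map f‖ ≤ ‖f‖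

namespace ContractiveFunctor

section
variable {𝕜 : Type u} [RCLike 𝕜]
  {A : Type w₁} [NormedCategory.{w₁, v₁} A] [BanachCategory 𝕜 A]
  {B : Type w₂} [NormedCategory.{w₂, v₂} B] [BanachCategory 𝕜 B]
  {C : Type w₃} [NormedCategory.{w₃, v₃} C] [BanachCategory 𝕜 C]

/-- The action on a hom-space, as a continuous linear map. -/
def mapCLM (F : ContractiveFunctor 𝕜 A B) (a b : A) :
    (a ⟶ b) →L[𝕜] (F.obj a ⟶ F.obj b) :=
  LinearMap.mkContinuous
    { toFun := fun f => F.map f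
      map_add' := F.map_add
      map_smul' := F.map_smul } 1 (fun f => by simpa using F.norm_map_le f)

/-- The composite of contractive functors, in diagrammatic order. -/
def comp (F : ContractiveFunctor 𝕜 A B) (G : ContractiveFunctor 𝕜 B C) :
    ContractiveFunctor 𝕜 A C where
  toFunctor := F.toFunctor ⋙ G.toFunctor
  map_add f g := by simp [F.map_add, G.map_add]
  map_smul r f := by simp [F.map_smul, G.map_smul]
  norm_map_le f := (G.norm_map_le _).trans (F.norm_map_le f)

/-- An equivalence of Banach categories, that is, an equivalence in the 2-category of Banach
categories, contractive functors and contractive natural transformations: there is a contractive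
functor in the other direction, and both composites are isomorphic to the identity through natural
isomorphisms that are contractive together with their inverses (hence isometric). -/
def IsBanachEquivalence (F : ContractiveFunctor 𝕜 A B) : Prop :=
  ∃ (G : ContractiveFunctor 𝕜 B A)
    (η : Functor.id A ≅ F.toFunctor ⋙ G.toFunctor)
    (ε : G.toFunctor ⋙ F.toFunctor ≅ Functor.id B),
    (∀ a : A, ‖η.hom.app a‖ ≤ 1 ∧ ‖η.inv.app a‖ ≤ 1) ∧
    (∀ b : B, ‖ε.hom.app b‖ ≤ 1 ∧ ‖ε.inv.app b‖ ≤ 1)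

/-- The space of bounded natural transformations `F ⟶ G`: the natural families
`τ a : F a ⟶ G a` with `sup ‖τ a‖ < ∞`, under the supremum norm. -/
def natTrans (F G : ContractiveFunctor 𝕜 A B) :
    Submodule 𝕜 (lp (fun a : A => F.obj a ⟶ G.obj a) ∞) where
  carrier := {τ | ∀ ⦃a b : A⦄ (f : a ⟶ b), F.map f ≫ τ b = τ a ≫ G.map f}
  add_mem' {σ τ} hσ hτ a b f := by
    simp only [lp.coeFn_add, Pi.add_apply, NormedCategory.add_comp, NormedCategory.comp_add]
    rw [hσ f, hτ f]
  zero_mem' a b f := by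
    have h1 : F.map f ≫ (0 : F.obj b ⟶ G.obj b) = 0 := by
      have := BanachCategory.comp_smul (0 : 𝕜) (F.map f) (0 : F.obj b ⟶ G.obj b)
      simpa using this
    have h2 : (0 : F.obj a ⟶ G.obj a) ≫ G.map f = 0 := by
      have := BanachCategory.smul_comp (0 : 𝕜) (0 : F.obj a ⟶ G.obj a) (G.map f)
      simpa using this
    simp only [lp.coeFn_zero, Pi.zero_apply, h1, h2]
  smul_mem' r τ hτ a b f := by
    simp only [lp.coeFn_smul, Pi.smul_apply, BanachCategory.comp_smul, BanachCategory.smul_comp]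
    rw [hτ f]

end

end ContractiveFunctor

/-! ## Banach spaces, weighted colimits, cocontinuous functors -/

/-- A (small) Banach space over `𝕜`. -/
structure Ban (𝕜 : Type u) [RCLike 𝕜] where
  carrier : Type u
  [normed : NormedAddCommGroup carrier]
  [space : NormedSpace 𝕜 carrier]
  [complete : CompleteSpace carrier]

instance (𝕜 : Type u) [RCLike 𝕜] : CoeSort (Ban 𝕜) (Type u) := ⟨Ban.carrier⟩

attribute [instance] Ban.normed Ban.space Ban.complete

/-- A weight on a small Banach category `J`: a contractive contravariant functor from `J` to
Banach spaces. -/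
structure Weight (𝕜 : Type u) [RCLike 𝕜]
    (J : Type u) [NormedCategory.{u, u} J] [BanachCategory 𝕜 J] where
  obj : J → Ban 𝕜
  map : ∀ {i j : J}, (i ⟶ j) → (obj j →L[𝕜] obj i)
  map_id : ∀ i : J, map (𝟙 i) = ContinuousLinearMap.id 𝕜 (obj i)
  map_comp : ∀ {i j k : J} (f : i ⟶ j) (g : j ⟶ k), map (f ≫ g) = (map f).comp (map g)
  map_add : ∀ {i j : J} (f g : i ⟶ j), map (f + g) = map f + map g
  map_smul : ∀ {i j : J} (r : 𝕜) (f : i ⟶ j), map (r • f) = r • map f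
  norm_map_le : ∀ {i j : J} (f : i ⟶ j), ‖map f‖ ≤ ‖f‖

section
variable {𝕜 : Type u} [RCLike 𝕜]
  {J : Type u} [NormedCategory.{u, u} J] [BanachCategory 𝕜 J]
  {A : Type w₁} [NormedCategory.{w₁, u} A] [BanachCategory 𝕜 A]
  {B : Type w₂} [NormedCategory.{w₂, u} B] [BanachCategory 𝕜 B]
  {C : Type w₃} [NormedCategory.{w₃, u} C] [BanachCategory 𝕜 C]

/-- A natural family of bounded linear maps `W j → A(D j, c)`; it is bounded by `K` when
`‖app j‖ ≤ K` for every `j`. -/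
structure Cylinder (W : Weight 𝕜 J) (D : ContractiveFunctor 𝕜 J A) (c : A) where
  app : ∀ j : J, W.obj j →L[𝕜] (D.obj j ⟶ c)
  naturality : ∀ {i j : J} (f : i ⟶ j) (s : W.obj j),
    app i (W.map f s) = D.map f ≫ app j s

/-- The contractive cylinder `l : W → A(D -, c)` exhibits `c` as the `W`-weighted colimit of `D`:
for every object `a`, the map `h ↦ l ≫ h` is an isometric isomorphism from `A(c, a)` onto the
Banach space of uniformly bounded cylinders `W → A(D -, a)`. (That map is a contraction because `l`
is one; bijectivity and contractivity of its inverse are spelled out here.) -/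
def Cylinder.IsColimit {W : Weight 𝕜 J} {D : ContractiveFunctor 𝕜 J A} {c : A}
    (l : Cylinder W D c) : Prop :=
  (∀ j : J, ‖l.app j‖ ≤ 1) ∧
  ∀ (a : A) (m : Cylinder W D a) (K : ℝ), 0 ≤ K → (∀ j : J, ‖m.app j‖ ≤ K) →
    ∃ h : c ⟶ a, ‖h‖ ≤ K ∧ (∀ (j : J) (s : W.obj j), l.app j s ≫ h = m.app j s) ∧
      ∀ h' : c ⟶ a, (∀ (j : J) (s : W.obj j), l.app j s ≫ h' = m.app j s) → h' = h

/-- The image of a cylinder under a contractive functor. -/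
def Cylinder.mapCyl {W : Weight 𝕜 J} {D : ContractiveFunctor 𝕜 J A} {c : A}
    (l : Cylinder W D c) (T : ContractiveFunctor 𝕜 A B) : Cylinder W (D.comp T) (T.obj c) where
  app j := (T.mapCLM (D.obj j) c).comp (l.app j)
  naturality f s := by
    change T.map (l.app _ (W.map f s)) = T.map (D.map f) ≫ T.map (l.app _ s)
    rw [l.naturality, T.map_comp]

/-- A contractive functor is cocontinuous when it preserves all small weighted colimits. -/
def ContractiveFunctor.IsCocontinuous (T : ContractiveFunctor 𝕜 A B) : Prop :=
  ∀ (J : Type u) [NormedCategory.{u, u} J] [BanachCategory 𝕜 J]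
    (W : Weight 𝕜 J) (D : ContractiveFunctor 𝕜 J A) (c : A) (l : Cylinder W D c),
    l.IsColimit → (l.mapCyl T).IsColimit

end

/-- Cocontinuous (contractive) functors `A → B`. -/
structure CocontFunctor (𝕜 : Type u) [RCLike 𝕜]
    (A : Type w₁) [NormedCategory.{w₁, u} A] [BanachCategory 𝕜 A]
    (B : Type w₂) [NormedCategory.{w₂, u} B] [BanachCategory 𝕜 B]
    extends ContractiveFunctor 𝕜 A B where
  cocontinuous : toContractiveFunctor.IsCocontinuous

namespace CocontFunctor

section
variable {𝕜 : Type u} [RCLike 𝕜]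
  {A : Type w₁} [NormedCategory.{w₁, u} A] [BanachCategory 𝕜 A]
  {B : Type w₂} [NormedCategory.{w₂, u} B] [BanachCategory 𝕜 B]
  {C : Type w₃} [NormedCategory.{w₃, u} C] [BanachCategory 𝕜 C]

/-- Vertical composition of bounded natural transformations. -/
def vcomp {F G H : ContractiveFunctor 𝕜 A B} (σ : F.natTrans G) (τ : G.natTrans H) :
    F.natTrans H :=
  ⟨⟨fun a => σ.1 a ≫ τ.1 a, memℓp_infty ⟨‖σ‖ * ‖τ‖, by
      rintro _ ⟨a, rfl⟩
      exact (NormedCategory.norm_comp_le _ _).trans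
        (mul_le_mul (lp.norm_apply_le_norm ENNReal.top_ne_zero σ.1 a)
          (lp.norm_apply_le_norm ENNReal.top_ne_zero τ.1 a) (norm_nonneg _) (norm_nonneg _))⟩⟩,
    fun a b f => by
      change F.map f ≫ σ.1 b ≫ τ.1 b = (σ.1 a ≫ τ.1 a) ≫ H.map f
      rw [← Category.assoc, σ.2 f, Category.assoc, τ.2 f, Category.assoc]⟩

/-- The identity transformation. -/
def idTrans (F : ContractiveFunctor 𝕜 A B) : F.natTrans F :=
  ⟨⟨fun a => 𝟙 (F.obj a), memℓp_infty ⟨1, by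
      rintro _ ⟨a, rfl⟩
      exact NormedCategory.norm_id_le _⟩⟩,
    fun a b f => by
      change F.map f ≫ 𝟙 _ = 𝟙 _ ≫ F.map f
      rw [Category.comp_id, Category.id_comp]⟩

theorem natTrans_ext {F G : ContractiveFunctor 𝕜 A B} {σ τ : F.natTrans G}
    (h : ∀ a, σ.1 a = τ.1 a) : σ = τ :=
  Subtype.ext (lp.ext (funext h))

theorem isClosed_natTrans (F G : ContractiveFunctor 𝕜 A B) :
    IsClosed (F.natTrans G : Set (lp (fun a : A => F.obj a ⟶ G.obj a) ∞)) := by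
  have happ : ∀ a : A, Continuous fun τ : lp (fun a : A => F.obj a ⟶ G.obj a) ∞ => τ a :=
    fun a => (LipschitzWith.of_dist_le_mul (K := 1) fun σ τ => by
      rw [dist_eq_norm, dist_eq_norm, NNReal.coe_one, one_mul]
      exact lp.norm_apply_le_norm ENNReal.top_ne_zero (σ - τ) a).continuous
  have hl : ∀ {a b c : B} (f : a ⟶ b), Continuous fun g : b ⟶ c => f ≫ g := fun {a b c} f =>
    ((LinearMap.mkContinuous (σ := RingHom.id 𝕜)
      { toFun := fun g : b ⟶ c => f ≫ g
        map_add' := NormedCategory.comp_add f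
        map_smul' := fun r g => BanachCategory.comp_smul r f g } ‖f‖
      (fun g => NormedCategory.norm_comp_le f g)).continuous)
  have hr : ∀ {a b c : B} (g : b ⟶ c), Continuous fun f : a ⟶ b => f ≫ g := fun {a b c} g =>
    ((LinearMap.mkContinuous (σ := RingHom.id 𝕜)
      { toFun := fun f : a ⟶ b => f ≫ g
        map_add' := fun f f' => NormedCategory.add_comp f f' g
        map_smul' := fun r f => BanachCategory.smul_comp r f g } ‖g‖
      (fun f => (NormedCategory.norm_comp_le f g).trans (mul_comm _ _).le)).continuous)
  have : (F.natTrans G : Set (lp (fun a : A => F.obj a ⟶ G.obj a) ∞)) =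
      ⋂ (a : A) (b : A) (f : a ⟶ b), {τ | F.map f ≫ τ b = τ a ≫ G.map f} := by
    ext τ
    simp only [Set.mem_iInter]
    exact Iff.rfl
  rw [this]
  exact isClosed_iInter fun a => isClosed_iInter fun b => isClosed_iInter fun f =>
    isClosed_eq ((hl _).comp (happ b)) ((hr _).comp (happ a))

/-- The Banach category of cocontinuous functors `A → B` and bounded natural transformations;
its contractions are the contractive natural transformations. -/
instance : NormedCategory (CocontFunctor 𝕜 A B) where
  Hom F G := F.toContractiveFunctor.natTrans G.toContractiveFunctor
  id F := idTrans F.toContractiveFunctor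
  comp σ τ := vcomp σ τ
  id_comp σ := natTrans_ext fun _ => Category.id_comp _
  comp_id σ := natTrans_ext fun _ => Category.comp_id _
  assoc ρ σ τ := natTrans_ext fun _ => Category.assoc _ _ _
  homNormed F G := inferInstanceAs
    (NormedAddCommGroup (F.toContractiveFunctor.natTrans G.toContractiveFunctor))
  homComplete F G :=
    (isClosed_natTrans F.toContractiveFunctor G.toContractiveFunctor).completeSpace_coe
  add_comp _ _ _ := natTrans_ext fun _ => NormedCategory.add_comp _ _ _
  comp_add _ _ _ := natTrans_ext fun _ => NormedCategory.comp_add _ _ _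
  norm_comp_le σ τ := lp.norm_le_of_forall_le (by positivity) fun a =>
    (NormedCategory.norm_comp_le _ _).trans
        (mul_le_mul (lp.norm_apply_le_norm ENNReal.top_ne_zero σ.1 a)
          (lp.norm_apply_le_norm ENNReal.top_ne_zero τ.1 a) (norm_nonneg _) (norm_nonneg _))
  norm_id_le F := lp.norm_le_of_forall_le zero_le_one fun _ => NormedCategory.norm_id_le _

instance : BanachCategory 𝕜 (CocontFunctor 𝕜 A B) where
  homSpace F G := inferInstanceAs
    (NormedSpace 𝕜 (F.toContractiveFunctor.natTrans G.toContractiveFunctor))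
  smul_comp _ _ _ := natTrans_ext fun _ => BanachCategory.smul_comp _ _ _
  comp_smul _ _ _ := natTrans_ext fun _ => BanachCategory.comp_smul _ _ _

/-- The component at `a` of a bounded natural transformation. -/
def app {F G : CocontFunctor 𝕜 A B} (τ : F ⟶ G) (a : A) : F.obj a ⟶ G.obj a :=
  (show F.toContractiveFunctor.natTrans G.toContractiveFunctor from τ).1 a

theorem app_naturality {F G : CocontFunctor 𝕜 A B} (τ : F ⟶ G) {a b : A} (f : a ⟶ b) :
    F.map f ≫ app τ b = app τ a ≫ G.map f :=
  (show F.toContractiveFunctor.natTrans G.toContractiveFunctor from τ).2 f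

theorem norm_app_le {F G : CocontFunctor 𝕜 A B} (τ : F ⟶ G) (a : A) : ‖app τ a‖ ≤ ‖τ‖ :=
  lp.norm_apply_le_norm ENNReal.top_ne_zero
    (show F.toContractiveFunctor.natTrans G.toContractiveFunctor from τ).1 a

/-- The composite `S T` of cocontinuous functors `T : A → B` and `S : B → C`. -/
def compose (S : CocontFunctor 𝕜 B C) (T : CocontFunctor 𝕜 A B) : CocontFunctor 𝕜 A C where
  toContractiveFunctor := T.toContractiveFunctor.comp S.toContractiveFunctor
  cocontinuous J _ _ W D c l hl := by
    have h := S.cocontinuous J W (D.comp T.toContractiveFunctor) _ _ (T.cocontinuous J W D c l hl)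
    exact ⟨h.1, fun a m K hK hm => h.2 a ⟨m.app, m.naturality⟩ K hK hm⟩

/-- Horizontal composition: the transformation `S T → S' T'` induced by `σ : S → S'` and
`τ : T → T'`. -/
def hcomp {S S' : CocontFunctor 𝕜 B C} {T T' : CocontFunctor 𝕜 A B} (σ : S ⟶ S') (τ : T ⟶ T') :
    compose S T ⟶ compose S' T' :=
  (show (compose S T).toContractiveFunctor.natTrans (compose S' T').toContractiveFunctor from
  ⟨⟨fun a => S.map (app τ a) ≫ app σ (T'.obj a), memℓp_infty ⟨‖τ‖ * ‖σ‖, by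
      rintro _ ⟨a, rfl⟩
      exact (NormedCategory.norm_comp_le _ _).trans
        (mul_le_mul ((S.norm_map_le _).trans (norm_app_le τ a)) (norm_app_le σ _)
          (norm_nonneg _) (norm_nonneg _))⟩⟩,
    fun a b f => by
      change S.map (T.map f) ≫ S.map (app τ b) ≫ app σ (T'.obj b) =
        (S.map (app τ a) ≫ app σ (T'.obj a)) ≫ S'.map (T'.map f)
      rw [← Category.assoc, ← S.map_comp, app_naturality τ f, S.map_comp, Category.assoc,
        Category.assoc, app_naturality σ]⟩)

end

end CocontFunctor

/-! ## Bundles of Banach spaces over a set -/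

/-- A bundle of Banach spaces over the set `X`: a family of Banach spaces indexed by `X`. -/
structure Bundle (𝕜 : Type u) [RCLike 𝕜] (X : Type u) where
  fiber : X → Ban 𝕜

namespace Bundle

section
variable {𝕜 : Type u} [RCLike 𝕜] {X Y Z : Type u}

/-- Maps of bundles: uniformly bounded families of bounded linear maps between the fibres, with
the supremum norm. -/
abbrev Map (ξ ζ : Bundle 𝕜 X) : Type u :=
  lp (fun x : X => ξ.fiber x →L[𝕜] ζ.fiber x) ∞

/-- The composite of bundle maps, in diagrammatic order. -/
def Map.comp {ξ ζ ρ : Bundle 𝕜 X} (f : Map ξ ζ) (g : Map ζ ρ) : Map ξ ρ :=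
  ⟨fun x => (g x).comp (f x), memℓp_infty ⟨‖g‖ * ‖f‖, by
      rintro _ ⟨x, rfl⟩
      exact (ContinuousLinearMap.opNorm_comp_le _ _).trans
        (mul_le_mul (lp.norm_apply_le_norm ENNReal.top_ne_zero g x)
          (lp.norm_apply_le_norm ENNReal.top_ne_zero f x) (norm_nonneg _) (norm_nonneg _))⟩⟩

/-- The identity bundle map. -/
def Map.ident (ξ : Bundle 𝕜 X) : Map ξ ξ :=
  ⟨fun x => ContinuousLinearMap.id 𝕜 (ξ.fiber x), memℓp_infty ⟨1, by
      rintro _ ⟨x, rfl⟩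
      exact ContinuousLinearMap.norm_id_le⟩⟩

/-- The Banach category of bundles over `X` and bounded bundle maps. -/
instance : NormedCategory (Bundle 𝕜 X) where
  Hom ξ ζ := Map ξ ζ
  id ξ := Map.ident ξ
  comp f g := Map.comp f g
  id_comp f := lp.ext (funext fun _ => rfl)
  comp_id f := lp.ext (funext fun _ => rfl)
  assoc f g h := lp.ext (funext fun _ => rfl)
  homNormed ξ ζ := inferInstanceAs (NormedAddCommGroup (Map ξ ζ))
  homComplete ξ ζ := inferInstanceAs (CompleteSpace (Map ξ ζ))
  add_comp f f' g := lp.ext (funext fun x => ContinuousLinearMap.comp_add (g.1 x) (f.1 x) (f'.1 x))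
  comp_add f g g' := lp.ext (funext fun x => ContinuousLinearMap.add_comp (g.1 x) (g'.1 x) (f.1 x))
  norm_comp_le f g := lp.norm_le_of_forall_le (by positivity) fun x =>
    (ContinuousLinearMap.opNorm_comp_le _ _).trans <| (mul_comm _ _).le.trans
        (mul_le_mul (lp.norm_apply_le_norm ENNReal.top_ne_zero f x)
          (lp.norm_apply_le_norm ENNReal.top_ne_zero g x) (norm_nonneg _) (norm_nonneg _))
  norm_id_le ξ := lp.norm_le_of_forall_le zero_le_one fun _ => ContinuousLinearMap.norm_id_le

instance : BanachCategory 𝕜 (Bundle 𝕜 X) where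
  homSpace ξ ζ := inferInstanceAs (NormedSpace 𝕜 (Map ξ ζ))
  smul_comp r f g := lp.ext (funext fun x => ContinuousLinearMap.comp_smul (g.1 x) r (f.1 x))
  comp_smul r f g := lp.ext (funext fun x => ContinuousLinearMap.smul_comp r (g.1 x) (f.1 x))

/-- The component over `x` of a morphism of bundles. -/
def fiberMap {ξ ζ : Bundle 𝕜 X} (f : ξ ⟶ ζ) (x : X) : ξ.fiber x →L[𝕜] ζ.fiber x :=
  (show Map ξ ζ from f) x

theorem norm_fiberMap_le {ξ ζ : Bundle 𝕜 X} (f : ξ ⟶ ζ) (x : X) : ‖fiberMap f x‖ ≤ ‖f‖ :=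
  lp.norm_apply_le_norm ENNReal.top_ne_zero (show Map ξ ζ from f) x

/-- A uniformly bounded family of bounded linear maps, as a morphism of bundles. -/
def mkHom {ξ ζ : Bundle 𝕜 X} (f : ∀ x : X, ξ.fiber x →L[𝕜] ζ.fiber x) (K : ℝ)
    (hf : ∀ x, ‖f x‖ ≤ K) : ξ ⟶ ζ :=
  (show Map ξ ζ from ⟨f, memℓp_infty ⟨K, by rintro _ ⟨x, rfl⟩; exact hf x⟩⟩)

theorem hom_ext {ξ ζ : Bundle 𝕜 X} {f g : ξ ⟶ ζ} (h : ∀ x, fiberMap f x = fiberMap g x) :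
    f = g :=
  lp.ext (E := fun x : X => ξ.fiber x →L[𝕜] ζ.fiber x) (funext h)

theorem norm_le_of_fiberMap {ξ ζ : Bundle 𝕜 X} (f : ξ ⟶ ζ) {K : ℝ} (hK : 0 ≤ K)
    (h : ∀ x, ‖fiberMap f x‖ ≤ K) : ‖f‖ ≤ K :=
  lp.norm_le_of_forall_le (E := fun x : X => ξ.fiber x →L[𝕜] ζ.fiber x) hK h

open Classical in
/-- The bundle `δ_x` whose fibre over `y` is `𝕜` if `y = x` and `0` otherwise. -/
def delta (𝕜 : Type u) [RCLike 𝕜] {X : Type u} (x : X) : Bundle 𝕜 X where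
  fiber y :=
    { carrier := ((if y = x then ⊤ else ⊥ : Submodule 𝕜 𝕜) : Type u)
      complete := FiniteDimensional.complete 𝕜 _ }

end

end Bundle

/-! ## The projective tensor product -/

section
variable (𝕜 : Type u) [RCLike 𝕜] (E F : Type u) [NormedAddCommGroup E] [NormedSpace 𝕜 E]
  [NormedAddCommGroup F] [NormedSpace 𝕜 F]

/-- The algebraic tensor product `E ⊗ F`, to be equipped with the projective norm. -/
def AlgTensor : Type u := E ⊗[𝕜] F

instance : AddCommGroup (AlgTensor 𝕜 E F) := inferInstanceAs (AddCommGroup (E ⊗[𝕜] F))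
instance : Module 𝕜 (AlgTensor 𝕜 E F) := inferInstanceAs (Module 𝕜 (E ⊗[𝕜] F))

variable {E F}

/-- The elementary tensor `a ⊗ b` in `AlgTensor 𝕜 E F`. -/
def AlgTensor.tmul (a : E) (b : F) : AlgTensor 𝕜 E F := TensorProduct.tmul 𝕜 a b

variable {𝕜}

/-- The numbers `∑ ‖aₙ‖ ‖bₙ‖`, over all finite representations `u = ∑ aₙ ⊗ bₙ`. -/
def AlgTensor.costs (t : AlgTensor 𝕜 E F) : Set ℝ :=
  {r | ∃ l : List (E × F), t = (l.map fun p => AlgTensor.tmul 𝕜 p.1 p.2).sum ∧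
    r = (l.map fun p => ‖p.1‖ * ‖p.2‖).sum}

theorem AlgTensor.costs_nonempty (t : AlgTensor 𝕜 E F) : t.costs.Nonempty := by
  suffices h : ∃ l : List (E × F), t = (l.map fun p => AlgTensor.tmul 𝕜 p.1 p.2).sum by
    obtain ⟨l, hl⟩ := h
    exact ⟨_, l, hl, rfl⟩
  refine TensorProduct.induction_on (motive := fun t : E ⊗[𝕜] F => ∃ l : List (E × F),
    (show AlgTensor 𝕜 E F from t) = (l.map fun p => AlgTensor.tmul 𝕜 p.1 p.2).sum) t ?_ ?_ ?_
  · exact ⟨[], rfl⟩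
  · intro a b
    exact ⟨[(a, b)], (add_zero (AlgTensor.tmul 𝕜 a b)).symm⟩
  · rintro s t ⟨l, hl⟩ ⟨m, hm⟩
    refine ⟨l ++ m, ?_⟩
    rw [List.map_append, List.sum_append, ← hl, ← hm]
    rfl

theorem AlgTensor.costs_nonneg (t : AlgTensor 𝕜 E F) : ∀ r ∈ t.costs, 0 ≤ r := by
  rintro r ⟨l, -, rfl⟩
  refine List.sum_nonneg ?_
  intro x hx
  obtain ⟨p, -, rfl⟩ := List.mem_map.1 hx
  positivity

/-- The projective norm on the algebraic tensor product. -/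
def AlgTensor.projNorm (t : AlgTensor 𝕜 E F) : ℝ := sInf t.costs

theorem AlgTensor.projNorm_zero : AlgTensor.projNorm (0 : AlgTensor 𝕜 E F) = 0 :=
  le_antisymm (csInf_le ⟨0, AlgTensor.costs_nonneg _⟩ ⟨[], rfl, rfl⟩)
    (Real.sInf_nonneg (AlgTensor.costs_nonneg _))

theorem AlgTensor.projNorm_add_le (s t : AlgTensor 𝕜 E F) :
    (s + t).projNorm ≤ s.projNorm + t.projNorm := by
  refine le_of_forall_pos_le_add fun ε hε => ?_
  obtain ⟨_, ⟨l, hl, rfl⟩, hl'⟩ := Real.lt_sInf_add_pos s.costs_nonempty (half_pos hε)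
  obtain ⟨_, ⟨m, hm, rfl⟩, hm'⟩ := Real.lt_sInf_add_pos t.costs_nonempty (half_pos hε)
  have h : (s + t).projNorm ≤ (l.map fun p => ‖p.1‖ * ‖p.2‖).sum +
      (m.map fun p => ‖p.1‖ * ‖p.2‖).sum :=
    csInf_le ⟨0, AlgTensor.costs_nonneg _⟩ ⟨l ++ m, by
      rw [List.map_append, List.sum_append, ← hl, ← hm], by
      rw [List.map_append, List.sum_append]⟩
  unfold AlgTensor.projNorm at h ⊢
  linarith

theorem AlgTensor.projNorm_smul_le (r : 𝕜) (t : AlgTensor 𝕜 E F) :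
    (r • t).projNorm ≤ ‖r‖ * t.projNorm := by
  refine le_of_forall_pos_le_add fun ε hε => ?_
  have hr : 0 < ‖r‖ + 1 := by positivity
  obtain ⟨_, ⟨l, hl, rfl⟩, hl'⟩ := Real.lt_sInf_add_pos t.costs_nonempty (div_pos hε hr)
  have h : (r • t).projNorm ≤ ‖r‖ * (l.map fun p => ‖p.1‖ * ‖p.2‖).sum := by
    refine csInf_le ⟨0, AlgTensor.costs_nonneg _⟩ ⟨l.map fun p => (r • p.1, p.2), ?_, ?_⟩
    · rw [hl, List.smul_sum, List.map_map, List.map_map]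
      rfl
    · rw [← List.sum_map_mul_left, List.map_map]
      congr 1
      refine List.map_congr_left fun p _ => ?_
      simp [norm_smul, mul_assoc]
  have h2 : ‖r‖ * (ε / (‖r‖ + 1)) ≤ ε := by
    rw [mul_div_assoc', div_le_iff₀ hr]
    nlinarith [norm_nonneg r]
  have h3 := mul_le_mul_of_nonneg_left hl'.le (norm_nonneg r)
  unfold AlgTensor.projNorm at h ⊢
  rw [mul_add] at h3
  linarith

instance : SeminormedAddCommGroup (AlgTensor 𝕜 E F) :=
  AddGroupSeminorm.toSeminormedAddCommGroup
    { toFun := AlgTensor.projNorm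
      map_zero' := AlgTensor.projNorm_zero
      add_le' := AlgTensor.projNorm_add_le
      neg' := fun t => by
        have h : ∀ s : AlgTensor 𝕜 E F, (-s).projNorm ≤ s.projNorm := fun s => by
          simpa using AlgTensor.projNorm_smul_le (-1 : 𝕜) s
        exact le_antisymm (h t) (by simpa using h (-t)) }

instance : NormedSpace 𝕜 (AlgTensor 𝕜 E F) where
  norm_smul_le := AlgTensor.projNorm_smul_le

variable (𝕜 E F)

/-- The projective tensor product: the completion of the algebraic tensor product under the
projective norm. -/
abbrev ProjTensor : Type u := UniformSpace.Completion (AlgTensor 𝕜 E F)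

variable {E F}

/-- The elementary tensor `a ⊗ b` in the projective tensor product. -/
def ProjTensor.tmul (a : E) (b : F) : ProjTensor 𝕜 E F := (AlgTensor.tmul 𝕜 a b : AlgTensor 𝕜 E F)

end

/-! ## Matrices of cocontinuous functors -/

namespace Bundle

section
variable {𝕜 : Type u} [RCLike 𝕜] {X Y Z : Type u}

/-- The entry of the matrix multiplication of `M` (over `Y × Z`) and `N` (over `X × Y`) at
`(x, z)`: the `ℓ¹`-sum over `y` of the projective tensor products `M (y, z) ⊗ N (x, y)`. -/
abbrev MatMulEntry (M : Bundle 𝕜 (Y × Z)) (N : Bundle 𝕜 (X × Y)) (p : X × Z) : Type u :=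
  lp (fun y : Y => ProjTensor 𝕜 (M.fiber (y, p.2)) (N.fiber (p.1, y))) 1

/-- Matrix multiplication of bundles. -/
def matMul (M : Bundle 𝕜 (Y × Z)) (N : Bundle 𝕜 (X × Y)) : Bundle 𝕜 (X × Z) where
  fiber p := { carrier := MatMulEntry M N p }

open Classical in
/-- The element of `∑_y M (y, z) ⊗ N (x, y)` that is `s ⊗ t` in the summand `y` and `0` in the
others. -/
def elemTensor (M : Bundle 𝕜 (Y × Z)) (N : Bundle 𝕜 (X × Y)) (x : X) (y : Y) (z : Z)
    (s : M.fiber (y, z)) (t : N.fiber (x, y)) : (matMul M N).fiber (x, z) :=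
  (show MatMulEntry M N (x, z) from lp.single 1 y (ProjTensor.tmul 𝕜 s t))

/-- The matrix `T_x^y = (T δ_x)_y` of a cocontinuous functor `T : Bundle X → Bundle Y`. -/
def matrixObj (T : CocontFunctor 𝕜 (Bundle 𝕜 X) (Bundle 𝕜 Y)) : Bundle 𝕜 (X × Y) where
  fiber p := (T.obj (delta 𝕜 p.1)).fiber p.2

/-- The map of matrices `(τ_{δ_x})_y : T_x^y → T'_x^y` induced by `τ : T → T'`. -/
def matrixMap {T T' : CocontFunctor 𝕜 (Bundle 𝕜 X) (Bundle 𝕜 Y)} (τ : T ⟶ T') :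
    matrixObj T ⟶ matrixObj T' :=
  mkHom (ξ := matrixObj T) (ζ := matrixObj T')
    (fun p => fiberMap (CocontFunctor.app τ (delta 𝕜 p.1)) p.2) ‖τ‖
    (fun p => (norm_fiberMap_le _ p.2).trans (CocontFunctor.norm_app_le τ _))

variable (𝕜 X Y) in
/-- The functor `T ↦ T_x^y`, from cocontinuous functors `Bundle X → Bundle Y` to bundles over
`X × Y`. -/
def matrix : ContractiveFunctor 𝕜 (CocontFunctor 𝕜 (Bundle 𝕜 X) (Bundle 𝕜 Y))
    (Bundle 𝕜 (X × Y)) where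
  obj T := matrixObj T
  map τ := matrixMap τ
  map_id _ := hom_ext fun _ => rfl
  map_comp _ _ := hom_ext fun _ => rfl
  map_add _ _ := hom_ext fun _ => rfl
  map_smul _ _ := hom_ext fun _ => rfl
  norm_map_le τ := norm_le_of_fiberMap _ (norm_nonneg τ) fun p =>
    (norm_fiberMap_le (CocontFunctor.app τ (delta 𝕜 p.1)) p.2).trans
      (CocontFunctor.norm_app_le τ _)

end

end Bundle

end

noncomputable section

/-! ## Universal properties of the projective tensor product and of `ℓ¹`-sums -/

namespace ProjTensor

section
variable {𝕜 : Type u} [RCLike 𝕜] {E F G : Type u} [NormedAddCommGroup E] [NormedSpace 𝕜 E]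
  [NormedAddCommGroup F] [NormedSpace 𝕜 F] [NormedAddCommGroup G] [NormedSpace 𝕜 G]

/-! The bundles `δ_x` generate `Bundle X` freely under weighted colimits. Evaluation at the
generator identifies `Hom(δ_x, ξ)` isometrically with `ξ_x`, and every `ξ` is the colimit of the
`δ_x` weighted by `x ↦ ξ_x` (`deltasCylinder_isColimit`). There are no nonzero maps between
different `δ_x`, and the endomorphisms of `δ_x` are the scalars. Hence for cocontinuous `T` a
morphism `T ξ ⟶ a` of norm at most `K` is an arbitrary family of linear maps `ξ_x → Hom(T δ_x, a)`
bounded by `K`, with no compatibility to check (`CocontFunctor.exists_desc`).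

This one universal property carries both parts of the theorem. A natural transformation out of `T`
is determined by its components at the `δ_x`, and any bounded family of such components extends
without increase of norm, so the matrix functor is isometrically fully faithful (`matrix_faithful`,
`matrix_full`). By the universal properties of `⊗` and of `ℓ¹`-sums, `∑ₓ T_x ⊗ ξ_x` represents the
same families, so it is isometrically isomorphic to `T ξ` (`exists_assembly_inverse`). Putting `S`
for `T` and `T δ_x` for `ξ` gives the matrix product formula.

Essential surjectivity needs a cocontinuous functor with a prescribed matrix `M`. The functor `ξ ↦
∑ₓ M (x, -) ⊗ ξ_x` has an isometric right adjoint, so it preserves weighted colimits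
(`convFunctor_isCocontinuous`), and its value at `δ_x` is the row `M (x, -)` (`matrixConvIso`). -/

theorem norm_tmul_le (a : E) (b : F) : ‖tmul 𝕜 a b‖ ≤ ‖a‖ * ‖b‖ := by
  refine (UniformSpace.Completion.norm_coe _).trans_le ?_
  exact csInf_le ⟨0, AlgTensor.costs_nonneg _⟩
    ⟨[(a, b)], (add_zero (AlgTensor.tmul 𝕜 a b)).symm, by simp⟩

variable (𝕜 E F) in
/-- The universal bounded bilinear map into the projective tensor product. -/
def mk : E →L[𝕜] F →L[𝕜] ProjTensor 𝕜 E F :=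
  LinearMap.mkContinuous₂
    (LinearMap.mk₂ 𝕜 (fun a b => tmul 𝕜 a b)
      (fun a a' b => by
        rw [tmul, tmul, tmul, ← UniformSpace.Completion.coe_add]
        exact congrArg _ (TensorProduct.add_tmul a a' b))
      (fun c a b => by
        rw [tmul, tmul, ← UniformSpace.Completion.coe_smul]
        exact congrArg _ (TensorProduct.smul_tmul' c a b).symm)
      (fun a b b' => by
        rw [tmul, tmul, tmul, ← UniformSpace.Completion.coe_add]
        exact congrArg _ (TensorProduct.tmul_add a b b'))
      (fun c a b => by
        rw [tmul, tmul, ← UniformSpace.Completion.coe_smul]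
        exact congrArg _ (TensorProduct.tmul_smul c a b))) 1
    (fun a b => by simpa using norm_tmul_le a b)

/-- A bounded bilinear map, as a linear map on the algebraic tensor product. -/
def algLift (B : E →L[𝕜] F →L[𝕜] G) : AlgTensor 𝕜 E F →ₗ[𝕜] G :=
  TensorProduct.lift (LinearMap.mk₂ 𝕜 (fun a b => B a b) (by simp) (by simp) (by simp) (by simp))

theorem algLift_tmul (B : E →L[𝕜] F →L[𝕜] G) (a : E) (b : F) :
    algLift B (AlgTensor.tmul 𝕜 a b) = B a b :=
  TensorProduct.lift.tmul a b

/-- Every finite representation `t = ∑ aₙ ⊗ bₙ` bounds the image by `‖B‖ ∑ ‖aₙ‖ ‖bₙ‖`; the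
projective norm is the infimum of these sums. -/
theorem norm_algLift_le (B : E →L[𝕜] F →L[𝕜] G) (t : AlgTensor 𝕜 E F) :
    ‖algLift B t‖ ≤ ‖B‖ * ‖t‖ := by
  have key : ∀ r ∈ t.costs, ‖algLift B t‖ ≤ ‖B‖ * r := by
    rintro _ ⟨l, rfl, rfl⟩
    induction l with
    | nil => simp
    | cons p l ih =>
      simp only [List.map_cons, List.sum_cons, map_add, mul_add, algLift_tmul]
      refine (norm_add_le _ _).trans (add_le_add ?_ ih)
      rw [← mul_assoc]
      exact B.le_opNorm₂ _ _
  -- The infimum is reached by dividing through by `‖B‖`, so `‖B‖ = 0` is treated separately.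
  rcases (norm_nonneg B).eq_or_lt with h | h
  · obtain ⟨r, hr⟩ := t.costs_nonempty
    simpa [← h] using key r hr
  · rw [← div_le_iff₀' h]
    exact le_csInf t.costs_nonempty fun r hr => (div_le_iff₀' h).2 (key r hr)

theorem denseRange_toComplL :
    DenseRange (UniformSpace.Completion.toComplL : AlgTensor 𝕜 E F →L[𝕜] ProjTensor 𝕜 E F) :=
  UniformSpace.Completion.denseRange_coe

/-- Extension to the completion requires the canonical map to be uniformly inducing with dense
range, not injective. It is therefore enough that the projective norm on `AlgTensor` is a seminorm.
-/
theorem isUniformInducing_toComplL : IsUniformInducing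
    (UniformSpace.Completion.toComplL : AlgTensor 𝕜 E F →L[𝕜] ProjTensor 𝕜 E F) :=
  UniformSpace.Completion.isUniformInducing_coe _

/-- Elementary tensors span the algebraic tensor product, which is dense in its completion. -/
theorem ext {f g : ProjTensor 𝕜 E F →L[𝕜] G} (h : ∀ a b, f (tmul 𝕜 a b) = g (tmul 𝕜 a b)) :
    f = g := by
  ext t
  induction t using UniformSpace.Completion.induction_on with
  | hp => exact isClosed_eq f.continuous g.continuous
  | ih t =>
    have : f.toLinearMap ∘ₗ (UniformSpace.Completion.toComplL :
          AlgTensor 𝕜 E F →L[𝕜] ProjTensor 𝕜 E F).toLinearMap =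
        g.toLinearMap ∘ₗ (UniformSpace.Completion.toComplL :
          AlgTensor 𝕜 E F →L[𝕜] ProjTensor 𝕜 E F).toLinearMap :=
      TensorProduct.ext' h
    exact LinearMap.congr_fun this t

variable [CompleteSpace G]

/-- The bounded linear map on the projective tensor product induced by a bounded bilinear map. -/
def lift (B : E →L[𝕜] F →L[𝕜] G) : ProjTensor 𝕜 E F →L[𝕜] G :=
  ((algLift B).mkContinuous ‖B‖ (norm_algLift_le B)).extend UniformSpace.Completion.toComplL

theorem lift_coe (B : E →L[𝕜] F →L[𝕜] G) (t : AlgTensor 𝕜 E F) :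
    lift B (t : ProjTensor 𝕜 E F) = algLift B t :=
  ContinuousLinearMap.extend_eq _ denseRange_toComplL isUniformInducing_toComplL t

@[simp] theorem lift_tmul (B : E →L[𝕜] F →L[𝕜] G) (a : E) (b : F) :
    lift B (tmul 𝕜 a b) = B a b :=
  (lift_coe B _).trans (algLift_tmul B a b)

theorem norm_lift_le (B : E →L[𝕜] F →L[𝕜] G) : ‖lift B‖ ≤ ‖B‖ := by
  refine ContinuousLinearMap.opNorm_le_bound _ B.opNorm_nonneg fun t => ?_
  induction t using UniformSpace.Completion.induction_on with
  | hp => exact isClosed_le (by fun_prop) (by fun_prop)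
  | ih t =>
    rw [lift_coe, UniformSpace.Completion.norm_coe]
    exact norm_algLift_le B t

end

end ProjTensor

/-! ### `ℓ¹`-sums of projective tensor products -/

namespace TensorSum

open Classical in
/-- The inclusion of a summand into an `ℓ¹`-sum of projective tensor products, as a bounded
bilinear map. -/
def elem {𝕜 : Type u} [RCLike 𝕜] {ι : Type u} (E F : ι → Type u)
    [∀ i, NormedAddCommGroup (E i)] [∀ i, NormedSpace 𝕜 (E i)]
    [∀ i, NormedAddCommGroup (F i)] [∀ i, NormedSpace 𝕜 (F i)] (i : ι) :
    E i →L[𝕜] F i →L[𝕜] lp (fun i => ProjTensor 𝕜 (E i) (F i)) 1 :=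
  (ContinuousLinearMap.compL 𝕜 (F i) (ProjTensor 𝕜 (E i) (F i)) _
    (lp.singleContinuousLinearMap 𝕜 (fun i => ProjTensor 𝕜 (E i) (F i)) 1 i)).comp
    (ProjTensor.mk 𝕜 (E i) (F i))

section
variable {𝕜 : Type u} [RCLike 𝕜] {ι : Type u} {E F : ι → Type u}
  [∀ i, NormedAddCommGroup (E i)] [∀ i, NormedSpace 𝕜 (E i)]
  [∀ i, NormedAddCommGroup (F i)] [∀ i, NormedSpace 𝕜 (F i)]
  {G : Type u} [NormedAddCommGroup G] [NormedSpace 𝕜 G]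

theorem norm_elem_apply_le (i : ι) (a : E i) (b : F i) : ‖elem (𝕜 := 𝕜) E F i a b‖ ≤ ‖a‖ * ‖b‖ := by
  classical
  exact (lp.norm_single one_pos _ _).trans_le (ProjTensor.norm_tmul_le a b)

/-- Finitely supported families are dense in `ℓ¹` because the exponent is finite, and elementary
tensors determine a bounded map on each summand. -/
theorem hom_ext {f g : lp (fun i => ProjTensor 𝕜 (E i) (F i)) 1 →L[𝕜] G}
    (h : ∀ i a b, f (elem E F i a b) = g (elem E F i a b)) : f = g := by
  classical
  refine lp.ext_continuousLinearMap ENNReal.one_ne_top fun i => ProjTensor.ext fun a b => ?_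
  exact h i a b

variable [CompleteSpace G]

theorem summable_of_norm_le {E : ι → Type u} [∀ i, NormedAddCommGroup (E i)]
    [∀ i, NormedSpace 𝕜 (E i)] (g : ∀ i, E i →L[𝕜] G) (K : ℝ)
    (hg : ∀ i, ‖g i‖ ≤ K) (t : lp E 1) :
    Summable fun i => g i (t i) := by
  have h : Summable fun i => ‖t i‖ := by
    simpa using (lp.memℓp t).summable (by simp)
  exact Summable.of_norm_bounded (h.mul_left K) fun i => (g i).le_of_opNorm_le (hg i) _

/-- The bounded linear map on an `ℓ¹`-sum of projective tensor products induced by a bounded family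
of bounded bilinear maps. -/
def lift (B : ∀ i, E i →L[𝕜] F i →L[𝕜] G) (K : ℝ) (hB : ∀ i, ‖B i‖ ≤ K) :
    lp (fun i => ProjTensor 𝕜 (E i) (F i)) 1 →L[𝕜] G :=
  have hs := summable_of_norm_le (fun i => ProjTensor.lift (B i)) K
    fun i => (ProjTensor.norm_lift_le _).trans (hB i)
  LinearMap.mkContinuous
    { toFun := fun t => ∑' i, ProjTensor.lift (B i) (t i)
      map_add' := fun s t => by
        simp only [lp.coeFn_add, Pi.add_apply, map_add]
        exact (hs s).tsum_add (hs t)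
      map_smul' := fun r t => by
        simp only [lp.coeFn_smul, Pi.smul_apply, map_smul]
        exact (hs t).tsum_const_smul r } K
    (fun t => by
      have h : HasSum (fun i => ‖t i‖) ‖t‖ := by
        simpa using lp.hasSum_norm (by simp) t
      exact tsum_of_norm_bounded (h.mul_left K) fun i =>
        (ProjTensor.lift (B i)).le_of_opNorm_le ((ProjTensor.norm_lift_le _).trans (hB i)) _)

theorem norm_lift_le (B : ∀ i, E i →L[𝕜] F i →L[𝕜] G) {K : ℝ} (hK : 0 ≤ K)
    (hB : ∀ i, ‖B i‖ ≤ K) : ‖lift B K hB‖ ≤ K := by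
  unfold lift
  exact LinearMap.mkContinuous_norm_le _ hK _

@[simp] theorem lift_elem (B : ∀ i, E i →L[𝕜] F i →L[𝕜] G) (K : ℝ) (hB : ∀ i, ‖B i‖ ≤ K)
    (i : ι) (a : E i) (b : F i) : lift B K hB (elem E F i a b) = B i a b := by
  classical
  change ∑' j, ProjTensor.lift (B j) (Pi.single (M := fun i => ProjTensor 𝕜 (E i) (F i)) i
    (ProjTensor.tmul 𝕜 a b) j) = _
  rw [tsum_eq_single i fun j hj => by rw [Pi.single_eq_of_ne hj, map_zero]]
  rw [Pi.single_eq_same, ProjTensor.lift_tmul]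

end

end TensorSum

/-! ## Morphisms out of the bundles `δ_x` -/

namespace Bundle

section
variable {𝕜 : Type u} [RCLike 𝕜] {X Y Z : Type u}

@[simp] theorem fiberMap_mkHom {ξ ζ : Bundle 𝕜 X} (f : ∀ x : X, ξ.fiber x →L[𝕜] ζ.fiber x)
    (K : ℝ) (hf : ∀ x, ‖f x‖ ≤ K) (x : X) : fiberMap (mkHom f K hf) x = f x := rfl

@[simp] theorem fiberMap_comp {ξ ζ ρ : Bundle 𝕜 X} (f : ξ ⟶ ζ) (g : ζ ⟶ ρ) (x : X) :
    fiberMap (f ≫ g) x = (fiberMap g x).comp (fiberMap f x) := rfl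

@[simp] theorem fiberMap_id (ξ : Bundle 𝕜 X) (x : X) :
    fiberMap (𝟙 ξ) x = ContinuousLinearMap.id 𝕜 (ξ.fiber x) := rfl

@[simp] theorem fiberMap_add {ξ ζ : Bundle 𝕜 X} (f g : ξ ⟶ ζ) (x : X) :
    fiberMap (f + g) x = fiberMap f x + fiberMap g x := rfl

@[simp] theorem fiberMap_smul {ξ ζ : Bundle 𝕜 X} (r : 𝕜) (f : ξ ⟶ ζ) (x : X) :
    fiberMap (r • f) x = r • fiberMap f x := rfl

@[simp] theorem fiberMap_zero {ξ ζ : Bundle 𝕜 X} (x : X) :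
    fiberMap (0 : ξ ⟶ ζ) x = 0 := rfl

open Classical in
theorem norm_piSingle_le {E : X → Type u} [∀ x, NormedAddCommGroup (E x)] (x y : X) (v : E x) :
    ‖Pi.single (M := E) x v y‖ ≤ ‖v‖ := by
  by_cases h : y = x
  · subst h
    rw [Pi.single_eq_same]
  · rw [Pi.single_eq_of_ne h, norm_zero]
    exact norm_nonneg v

/-- The generator of the fibre of `δ_x` over `x`. -/
def deltaOne (𝕜 : Type u) [RCLike 𝕜] {X : Type u} (x : X) : (delta 𝕜 x).fiber x :=
  ⟨1, by simp⟩

theorem norm_deltaOne (x : X) : ‖deltaOne 𝕜 x‖ = 1 := norm_one (α := 𝕜)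

/-- The fibres of `δ_x` are subspaces of the scalars. -/
def deltaVal (𝕜 : Type u) [RCLike 𝕜] {X : Type u} (x y : X) : (delta 𝕜 x).fiber y →L[𝕜] 𝕜 :=
  Submodule.subtypeL _

@[simp] theorem deltaVal_deltaOne (x : X) : deltaVal 𝕜 x x (deltaOne 𝕜 x) = 1 := rfl

theorem norm_deltaVal_apply (x y : X) (c : (delta 𝕜 x).fiber y) : ‖deltaVal 𝕜 x y c‖ = ‖c‖ := rfl

theorem deltaVal_injective (x y : X) : Function.Injective (deltaVal 𝕜 x y) :=
  Subtype.val_injective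

theorem delta_fiber_self (x : X) (c : (delta 𝕜 x).fiber x) :
    c = deltaVal 𝕜 x x c • deltaOne 𝕜 x :=
  deltaVal_injective x x (by simp)

open Classical in
theorem delta_fiber_of_ne {x y : X} (h : y ≠ x) (c : (delta 𝕜 x).fiber y) : c = 0 := by
  refine deltaVal_injective x y ?_
  have hc : deltaVal 𝕜 x y c ∈ (if y = x then ⊤ else ⊥ : Submodule 𝕜 𝕜) := c.2
  rw [if_neg h] at hc
  rw [map_zero]
  exact (Submodule.mem_bot 𝕜).1 hc

/-- The fibre of `δ_x` over `x` is spanned by the generator, and the other fibres vanish. -/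
theorem delta_hom_ext {x : X} {ξ : Bundle 𝕜 X} {f g : delta 𝕜 x ⟶ ξ}
    (h : fiberMap f x (deltaOne 𝕜 x) = fiberMap g x (deltaOne 𝕜 x)) : f = g := by
  refine hom_ext fun y => ContinuousLinearMap.ext fun c => ?_
  by_cases hy : y = x
  · subst hy
    rw [delta_fiber_self y c, map_smul, map_smul, h]
  · rw [delta_fiber_of_ne hy c, map_zero, map_zero]

open Classical in
/-- The morphism `δ_x ⟶ ξ` that corresponds to an element of the fibre of `ξ` over `x`. -/
def point {x : X} {ξ : Bundle 𝕜 X} (v : ξ.fiber x) : delta 𝕜 x ⟶ ξ :=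
  mkHom (fun y => (deltaVal 𝕜 x y).smulRight (Pi.single (M := fun y => ξ.fiber y) x v y)) ‖v‖
    fun y => ContinuousLinearMap.opNorm_le_bound _ (norm_nonneg v) fun c => by
      rw [ContinuousLinearMap.smulRight_apply, norm_smul, norm_deltaVal_apply, mul_comm]
      exact mul_le_mul_of_nonneg_right (norm_piSingle_le (E := fun y => ξ.fiber y) x y v) (norm_nonneg c)

@[simp] theorem point_deltaOne {x : X} {ξ : Bundle 𝕜 X} (v : ξ.fiber x) :
    fiberMap (point v) x (deltaOne 𝕜 x) = v := by
  simp [point]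

/-- With `point_deltaOne` this makes `point` and evaluation at the generator mutually inverse. Both
are contractions, so `Hom(δ_x, ξ) ≅ ξ_x` isometrically; `point_comp` is the naturality of this
isomorphism in `ξ`. -/
theorem point_fiberMap {x : X} {ξ : Bundle 𝕜 X} (f : delta 𝕜 x ⟶ ξ) :
    point (fiberMap f x (deltaOne 𝕜 x)) = f :=
  delta_hom_ext (by simp)

theorem point_comp {x : X} {ξ ζ : Bundle 𝕜 X} (v : ξ.fiber x) (f : ξ ⟶ ζ) :
    point v ≫ f = point (fiberMap f x v) :=
  delta_hom_ext (by simp)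

theorem norm_point_le {x : X} {ξ : Bundle 𝕜 X} (v : ξ.fiber x) : ‖point v‖ ≤ ‖v‖ :=
  norm_le_of_fiberMap _ (norm_nonneg v) fun y =>
    ContinuousLinearMap.opNorm_le_bound _ (norm_nonneg v) fun c => by
      rw [point, fiberMap_mkHom, ContinuousLinearMap.smulRight_apply, norm_smul,
        norm_deltaVal_apply, mul_comm]
      exact mul_le_mul_of_nonneg_right (norm_piSingle_le (E := fun y => ξ.fiber y) x y v) (norm_nonneg c)

/-- Elements of the fibre over `x` as morphisms from `δ_x`, linearly. -/
def pointCLM (ξ : Bundle 𝕜 X) (x : X) : ξ.fiber x →L[𝕜] (delta 𝕜 x ⟶ ξ) :=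
  LinearMap.mkContinuous
    { toFun := fun v => point v
      map_add' := fun v w => delta_hom_ext (by simp)
      map_smul' := fun r v => delta_hom_ext (by simp) } 1
    (fun v => by simpa using norm_point_le v)

/-- Evaluation of morphisms out of `δ_x` at the generator. -/
def evalDelta (ξ : Bundle 𝕜 X) (x : X) : (delta 𝕜 x ⟶ ξ) →L[𝕜] ξ.fiber x :=
  LinearMap.mkContinuous
    { toFun := fun f => fiberMap f x (deltaOne 𝕜 x)
      map_add' := fun f g => by simp
      map_smul' := fun r f => by simp } 1
    (fun f => by
      simpa [norm_deltaOne] using (fiberMap f x).le_of_opNorm_le (norm_fiberMap_le f x)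
        (deltaOne 𝕜 x))

@[simp] theorem evalDelta_apply {ξ : Bundle 𝕜 X} {x : X} (f : delta 𝕜 x ⟶ ξ) :
    evalDelta ξ x f = fiberMap f x (deltaOne 𝕜 x) := rfl

theorem norm_evalDelta_le (ξ : Bundle 𝕜 X) (x : X) : ‖evalDelta ξ x‖ ≤ 1 := by
  unfold evalDelta
  exact LinearMap.mkContinuous_norm_le _ zero_le_one _

/-! ### Density of the bundles `δ_x` -/

/-- The set `X`, as the full Banach subcategory of `Bundle X` on the bundles `δ_x`. -/
structure Deltas (𝕜 : Type u) [RCLike 𝕜] (X : Type u) : Type u where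
  pt : X

instance : NormedCategory (Deltas 𝕜 X) where
  Hom x y := delta 𝕜 x.pt ⟶ delta 𝕜 y.pt
  id x := 𝟙 (delta 𝕜 x.pt)
  comp f g := NormedCategory.toCategory.comp f g
  id_comp f := Category.id_comp (obj := Bundle 𝕜 X) f
  comp_id f := Category.comp_id (obj := Bundle 𝕜 X) f
  assoc f g h := Category.assoc (obj := Bundle 𝕜 X) f g h
  homNormed x y := NormedCategory.homNormed (delta 𝕜 x.pt) (delta 𝕜 y.pt)
  homComplete x y := NormedCategory.homComplete (delta 𝕜 x.pt) (delta 𝕜 y.pt)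
  add_comp f f' g := NormedCategory.add_comp (A := Bundle 𝕜 X) f f' g
  comp_add f g g' := NormedCategory.comp_add (A := Bundle 𝕜 X) f g g'
  norm_comp_le f g := NormedCategory.norm_comp_le (A := Bundle 𝕜 X) f g
  norm_id_le x := NormedCategory.norm_id_le (delta 𝕜 x.pt)

instance : BanachCategory 𝕜 (Deltas 𝕜 X) where
  homSpace x y := BanachCategory.homSpace (delta 𝕜 x.pt) (delta 𝕜 y.pt)
  smul_comp r f g := BanachCategory.smul_comp (A := Bundle 𝕜 X) r f g
  comp_smul r f g := BanachCategory.comp_smul (A := Bundle 𝕜 X) r f g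

/-- The inclusion of the bundles `δ_x`. -/
def deltasInclusion (𝕜 : Type u) [RCLike 𝕜] (X : Type u) :
    ContractiveFunctor 𝕜 (Deltas 𝕜 X) (Bundle 𝕜 X) where
  obj x := delta 𝕜 x.pt
  map f := f
  map_id _ := rfl
  map_comp _ _ := rfl
  map_add _ _ := rfl
  map_smul _ _ := rfl
  norm_map_le _ := le_rfl

/-- Precomposition with a morphism, as a bounded linear map. -/
def precompCLM {a b : Bundle 𝕜 X} (f : a ⟶ b) (c : Bundle 𝕜 X) : (b ⟶ c) →L[𝕜] (a ⟶ c) :=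
  LinearMap.mkContinuous
    { toFun := fun g => f ≫ g
      map_add' := NormedCategory.comp_add f
      map_smul' := fun r g => BanachCategory.comp_smul r f g } ‖f‖
    (fun g => NormedCategory.norm_comp_le f g)

/-- Postcomposition with a morphism, as a bounded linear map. -/
def postcompCLM (a : Bundle 𝕜 X) {b c : Bundle 𝕜 X} (g : b ⟶ c) : (a ⟶ b) →L[𝕜] (a ⟶ c) :=
  LinearMap.mkContinuous
    { toFun := fun f => f ≫ g
      map_add' := fun f f' => NormedCategory.add_comp f f' g
      map_smul' := fun r f => BanachCategory.smul_comp r f g } ‖g‖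
    (fun f => (NormedCategory.norm_comp_le f g).trans_eq (mul_comm _ _))

/-- The weight `x ↦ ξ_x ≅ Hom(δ_x, ξ)`. -/
def deltasWeight (ξ : Bundle 𝕜 X) : Weight 𝕜 (Deltas 𝕜 X) where
  obj x := ξ.fiber x.pt
  map {x y} f := (evalDelta ξ x.pt).comp
    ((precompCLM (a := delta 𝕜 x.pt) (b := delta 𝕜 y.pt) f ξ).comp (pointCLM ξ y.pt))
  map_id x := by
    refine ContinuousLinearMap.ext fun v => ?_
    change fiberMap (𝟙 (delta 𝕜 x.pt) ≫ point v) x.pt _ = v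
    simp
  map_comp {x y z} f g := by
    refine ContinuousLinearMap.ext fun v => ?_
    change fiberMap (NormedCategory.toCategory.comp (X := delta 𝕜 x.pt) (Y := delta 𝕜 y.pt)
      (Z := delta 𝕜 z.pt) f g ≫ point v) x.pt _ =
      fiberMap (NormedCategory.toCategory.comp (X := delta 𝕜 x.pt) (Y := delta 𝕜 y.pt) f
        (point (fiberMap (NormedCategory.toCategory.comp (X := delta 𝕜 y.pt) (Y := delta 𝕜 z.pt)
          g (point v)) y.pt (deltaOne 𝕜 y.pt)))) x.pt _
    rw [point_fiberMap, Category.assoc]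
  map_add f g := ContinuousLinearMap.ext fun v => congrArg (evalDelta ξ _)
    (NormedCategory.add_comp (A := Bundle 𝕜 X) f g (point v))
  map_smul r f := ContinuousLinearMap.ext fun v => congrArg (evalDelta ξ _)
    (BanachCategory.smul_comp (A := Bundle 𝕜 X) r f (point v))
  norm_map_le {x y} f := ContinuousLinearMap.opNorm_le_bound _ (norm_nonneg f) fun v =>
    ((evalDelta ξ x.pt).le_of_opNorm_le (norm_evalDelta_le ξ x.pt) _).trans <|
      (one_mul _).trans_le <| (NormedCategory.norm_comp_le (A := Bundle 𝕜 X) f (point v)).trans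
        (mul_le_mul_of_nonneg_left (norm_point_le v) (norm_nonneg f))

/-- The tautological cylinder under the bundles `δ_x`. -/
def deltasCylinder (ξ : Bundle 𝕜 X) :
    Cylinder (deltasWeight ξ) (deltasInclusion 𝕜 X) ξ where
  app x := pointCLM ξ x.pt
  naturality {x y} f v := point_fiberMap (x := x.pt)
    (NormedCategory.toCategory.comp (X := delta 𝕜 x.pt) (Y := delta 𝕜 y.pt) f (point v))

theorem norm_pointCLM_le (ξ : Bundle 𝕜 X) (x : X) : ‖pointCLM ξ x‖ ≤ 1 := by
  unfold pointCLM
  exact LinearMap.mkContinuous_norm_le _ zero_le_one _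

/-- Every bundle is a weighted colimit of the bundles `δ_x`. -/
theorem deltasCylinder_isColimit (ξ : Bundle 𝕜 X) : (deltasCylinder ξ).IsColimit := by
  refine ⟨fun x => norm_pointCLM_le ξ x.pt, fun a m K hK hm => ?_⟩
  -- The component of the mediating morphism over `x` is the composite `ξ_x → Hom(δ_x, a) ≅ a_x`,
  -- which is bounded by `K` because evaluation is a contraction.
  have hb : ∀ x, ‖(evalDelta a x).comp (m.app ⟨x⟩)‖ ≤ K := fun x =>
    (ContinuousLinearMap.opNorm_comp_le _ _).trans <|
      (mul_le_mul (norm_evalDelta_le a x) (hm ⟨x⟩) (norm_nonneg _) zero_le_one).trans_eq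
        (one_mul K)
  refine ⟨mkHom (fun x => (evalDelta a x).comp (m.app ⟨x⟩)) K hb,
    norm_le_of_fiberMap _ hK hb, fun x v => ?_, fun h' hh' => ?_⟩
  · change ξ.fiber x.pt at v
    refine delta_hom_ext (x := x.pt) ?_
    change fiberMap (point v ≫ mkHom _ K hb) _ _ = _
    rw [point_comp, point_deltaOne]
    rfl
  -- The value of `h'` at `v` is recovered from `point v ≫ h'`, which the cylinder prescribes.
  · refine hom_ext fun x => ContinuousLinearMap.ext fun v => ?_
    have h := hh' ⟨x⟩ v
    change point (x := x) v ≫ h' = _ at h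
    rw [point_comp] at h
    rw [← point_deltaOne (fiberMap h' x v), h]
    rfl

/-- Together with `hom_eq_zero`, this says that the full subcategory on the `δ_x` is the free linear
category on the discrete set `X`. Naturality over it reduces to linearity. -/
theorem hom_eq_smul (x : X) (f : delta 𝕜 x ⟶ delta 𝕜 x) :
    f = deltaVal 𝕜 x x (fiberMap f x (deltaOne 𝕜 x)) • 𝟙 (delta 𝕜 x) :=
  delta_hom_ext (by simpa using delta_fiber_self x _)

theorem hom_eq_zero {x y : X} (h : x ≠ y) (f : delta 𝕜 x ⟶ delta 𝕜 y) : f = 0 :=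
  delta_hom_ext (delta_fiber_of_ne h _ |>.trans (by simp))

/-! ### The universal property of `T ξ` -/

/-- Morphisms out of `T ξ`, for a cocontinuous functor `T`, are the bounded families of linear maps
`ξ_x → Hom(T δ_x, a)`. -/
theorem _root_.CocontFunctor.exists_desc (T : CocontFunctor 𝕜 (Bundle 𝕜 X) (Bundle 𝕜 Y)) {ξ : Bundle 𝕜 X}
    {a : Bundle 𝕜 Y} (φ : ∀ x, ξ.fiber x →L[𝕜] (T.obj (delta 𝕜 x) ⟶ a)) {K : ℝ} (hK : 0 ≤ K)
    (hφ : ∀ x, ‖φ x‖ ≤ K) :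
    ∃ h : T.obj ξ ⟶ a, ‖h‖ ≤ K ∧ (∀ x (v : ξ.fiber x), T.map (point v) ≫ h = φ x v) ∧
      ∀ h' : T.obj ξ ⟶ a, (∀ x (v : ξ.fiber x), T.map (point v) ≫ h' = φ x v) → h' = h := by
  have hT := (T.cocontinuous _ _ _ _ _ (deltasCylinder_isColimit ξ)).2 a
    { app := fun x => φ x.pt
      naturality := ?_ } K hK (fun x => hφ x.pt)
  · obtain ⟨h, h1, h2, h3⟩ := hT
    exact ⟨h, h1, fun x v => h2 ⟨x⟩ v, fun h' hh' => h3 h' fun x v => hh' x.pt v⟩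
  · rintro ⟨x⟩ ⟨y⟩ f v
    change ξ.fiber y at v
    change φ x (fiberMap (NormedCategory.toCategory.comp (X := delta 𝕜 x) (Y := delta 𝕜 y) f
      (point v)) x (deltaOne 𝕜 x)) = T.map (X := delta 𝕜 x) (Y := delta 𝕜 y) f ≫ φ y v
    change delta 𝕜 x ⟶ delta 𝕜 y at f
    -- Naturality is automatic: either `f` is a scalar multiple of the identity and both sides are
    -- scaled by it, or `f = 0` and both sides vanish.
    by_cases h : x = y
    · subst h
      rw [hom_eq_smul x f, BanachCategory.smul_comp, T.map_smul, BanachCategory.smul_comp,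
        T.map_id, Category.id_comp, Category.id_comp]
      simp
    · obtain rfl := hom_eq_zero h f
      have h1 : T.map (0 : delta 𝕜 x ⟶ delta 𝕜 y) = 0 := by
        simpa using T.map_smul (0 : 𝕜) (0 : delta 𝕜 x ⟶ delta 𝕜 y)
      rw [h1]
      have h2 : (0 : T.obj (delta 𝕜 x) ⟶ T.obj (delta 𝕜 y)) ≫ φ y v = 0 :=
        hom_ext fun z => by simp
      rw [h2, fiberMap_comp]
      simp

/-- The morphisms `T (point v)` are jointly epic. Both `f` and `g` solve the extension problem for
the family `v ↦ T (point v) ≫ g`, which is bounded by `‖g‖`, and its solution is unique. -/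
theorem _root_.CocontFunctor.hom_ext (T : CocontFunctor 𝕜 (Bundle 𝕜 X) (Bundle 𝕜 Y)) {ξ : Bundle 𝕜 X}
    {a : Bundle 𝕜 Y} {f g : T.obj ξ ⟶ a}
    (h : ∀ x (v : ξ.fiber x), T.map (point v) ≫ f = T.map (point v) ≫ g) : f = g := by
  have hb : ∀ x, ‖(postcompCLM (T.obj (delta 𝕜 x)) g).comp
      ((T.mapCLM (delta 𝕜 x) ξ).comp (pointCLM ξ x))‖ ≤ ‖g‖ := fun x =>
    ContinuousLinearMap.opNorm_le_bound _ (norm_nonneg g) fun v =>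
      (NormedCategory.norm_comp_le (T.map (point v)) g).trans <| (mul_comm _ _).trans_le <|
        mul_le_mul_of_nonneg_left ((T.norm_map_le _).trans (norm_point_le v)) (norm_nonneg g)
  obtain ⟨k, -, -, hk⟩ := T.exists_desc _ (norm_nonneg g) hb
  rw [hk f h, hk g fun _ _ => rfl]

end

end Bundle

/-! ## A criterion for equivalences -/

namespace ContractiveFunctor

section
variable {𝕜 : Type u} [RCLike 𝕜]
  {A : Type w₁} [NormedCategory.{w₁, v₁} A] [BanachCategory 𝕜 A]
  {B : Type w₂} [NormedCategory.{w₂, v₂} B] [BanachCategory 𝕜 B]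

theorem norm_mapCLM_le (F : ContractiveFunctor 𝕜 A B) (a b : A) : ‖F.mapCLM a b‖ ≤ 1 :=
  LinearMap.mkContinuous_norm_le _ zero_le_one _

theorem norm_comp_le_of_le {a b c : A} {f : a ⟶ b} {g : b ⟶ c} {r s : ℝ} (hf : ‖f‖ ≤ r)
    (hg : ‖g‖ ≤ s) : ‖f ≫ g‖ ≤ r * s :=
  (NormedCategory.norm_comp_le f g).trans
    (mul_le_mul hf hg (norm_nonneg g) ((norm_nonneg f).trans hf))

/-- A contractive functor that is isometrically fully faithful and essentially surjective up to
isometric isomorphism is an equivalence of Banach categories. -/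
theorem IsBanachEquivalence.of_fullyFaithful (F : ContractiveFunctor 𝕜 A B)
    (hfull : ∀ (a a' : A) (g : F.obj a ⟶ F.obj a'), ∃ f : a ⟶ a', F.map f = g ∧ ‖f‖ ≤ ‖g‖)
    (hfaith : ∀ (a a' : A) (f f' : a ⟶ a'), F.map f = F.map f' → f = f')
    (hsurj : ∀ b : B, ∃ (a : A) (e : F.obj a ≅ b), ‖e.hom‖ ≤ 1 ∧ ‖e.inv‖ ≤ 1) :
    F.IsBanachEquivalence := by
  choose pre hpre hnorm using hfull
  choose obj e he using hsurj
  -- Preimages under `F` are unique, so any identity among them may be checked after applying `F`;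
  -- this makes `pre` compatible with identities and composition.
  have hid : ∀ a, pre a a (𝟙 _) = 𝟙 a := fun a => hfaith _ _ _ _ (by rw [hpre, F.map_id])
  have hcomp : ∀ a b c (f : F.obj a ⟶ F.obj b) (g : F.obj b ⟶ F.obj c),
      pre a c (f ≫ g) = pre a b f ≫ pre b c g := fun a b c f g =>
    hfaith _ _ _ _ (by rw [hpre, F.map_comp, hpre, hpre])
  -- The inverse functor conjugates by the chosen isomorphisms `e` and takes preimages.
  -- Contractivity of `e.hom` and `e.inv` keeps the norm from growing.
  let G : ContractiveFunctor 𝕜 B A :=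
    { obj := obj
      map := fun {b c} f => pre _ _ ((e b).hom ≫ f ≫ (e c).inv)
      map_id := fun b => by simp [hid]
      map_comp := fun f g => by simp [← hcomp]
      map_add := fun {b c} f g => hfaith _ _ _ _ (by
        simp only [hpre, F.map_add, NormedCategory.add_comp, NormedCategory.comp_add])
      map_smul := fun {b c} r f => hfaith _ _ _ _ (by
        simp only [hpre, F.map_smul, BanachCategory.smul_comp, BanachCategory.comp_smul])
      norm_map_le := fun {b c} f => (hnorm _ _ _).trans <| by
        simpa using norm_comp_le_of_le (he b).1 (norm_comp_le_of_le (le_refl ‖f‖) (he c).2) }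
  -- The unit at `a` is the preimage of `(e (F a))⁻¹`, and the counit is `e` itself.
  refine ⟨G, NatIso.ofComponents (fun a => ⟨pre _ _ (e (F.obj a)).inv, pre _ _ (e (F.obj a)).hom,
    by rw [← hcomp, Iso.inv_hom_id, hid], by rw [← hcomp, Iso.hom_inv_id]; exact hid _⟩)
    (fun {a b} f => hfaith _ _ _ _ ?_),
    NatIso.ofComponents (fun b => e b) (fun {b c} f => ?_), fun a => ⟨?_, ?_⟩, fun b => he b⟩
  · simp [G, hpre]
  · simp [G, hpre]
  · exact (hnorm _ _ _).trans (he _).2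
  · exact (hnorm _ _ _).trans (he _).1

end

end ContractiveFunctor

/-! ## The cocontinuous functor of a matrix -/

namespace Bundle

section
variable {𝕜 : Type u} [RCLike 𝕜] {X Y Z : Type u}

/-- The product of a matrix over `X × Y` and a bundle over `X`: its fibre over `y` is the `ℓ¹`-sum
over `x` of the projective tensor products `M (x, y) ⊗ ξ x`. -/
def conv (M : Bundle 𝕜 (X × Y)) (ξ : Bundle 𝕜 X) : Bundle 𝕜 Y where
  fiber y := { carrier := lp (fun x => ProjTensor 𝕜 (M.fiber (x, y)) (ξ.fiber x)) 1 }

/-- The element `m ⊗ v` of the summand `x`. -/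
def convElem (M : Bundle 𝕜 (X × Y)) (ξ : Bundle 𝕜 X) (x : X) (y : Y) :
    M.fiber (x, y) →L[𝕜] ξ.fiber x →L[𝕜] (conv M ξ).fiber y :=
  TensorSum.elem (fun x => M.fiber (x, y)) (fun x => ξ.fiber x) x

theorem norm_convElem_le (M : Bundle 𝕜 (X × Y)) (ξ : Bundle 𝕜 X) (x : X) (y : Y)
    (m : M.fiber (x, y)) (v : ξ.fiber x) : ‖convElem M ξ x y m v‖ ≤ ‖m‖ * ‖v‖ :=
  TensorSum.norm_elem_apply_le (E := fun x => M.fiber (x, y)) (F := fun x => ξ.fiber x) x m v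

theorem conv_hom_ext {M : Bundle 𝕜 (X × Y)} {ξ : Bundle 𝕜 X} {a : Bundle 𝕜 Y}
    {f g : conv M ξ ⟶ a}
    (h : ∀ x y m v, fiberMap f y (convElem M ξ x y m v) = fiberMap g y (convElem M ξ x y m v)) :
    f = g :=
  hom_ext fun y => TensorSum.hom_ext (E := fun x => M.fiber (x, y)) (F := fun x => ξ.fiber x)
    fun x m v => h x y m v

/-- The morphism out of a product induced by a bounded family of bounded bilinear maps. -/
def convLift {M : Bundle 𝕜 (X × Y)} {ξ : Bundle 𝕜 X} {a : Bundle 𝕜 Y}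
    (B : ∀ y x, M.fiber (x, y) →L[𝕜] ξ.fiber x →L[𝕜] a.fiber y) {K : ℝ} (hK : 0 ≤ K)
    (hB : ∀ y x, ‖B y x‖ ≤ K) : conv M ξ ⟶ a :=
  mkHom (ξ := conv M ξ) (fun y => TensorSum.lift (E := fun x => M.fiber (x, y)) (B y) K (hB y)) K
    fun y => TensorSum.norm_lift_le (B y) hK (hB y)

theorem norm_convLift_le {M : Bundle 𝕜 (X × Y)} {ξ : Bundle 𝕜 X} {a : Bundle 𝕜 Y}
    (B : ∀ y x, M.fiber (x, y) →L[𝕜] ξ.fiber x →L[𝕜] a.fiber y) {K : ℝ} (hK : 0 ≤ K)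
    (hB : ∀ y x, ‖B y x‖ ≤ K) : ‖convLift B hK hB‖ ≤ K :=
  norm_le_of_fiberMap _ hK fun y => TensorSum.norm_lift_le (B y) hK (hB y)

@[simp] theorem convLift_convElem {M : Bundle 𝕜 (X × Y)} {ξ : Bundle 𝕜 X} {a : Bundle 𝕜 Y}
    (B : ∀ y x, M.fiber (x, y) →L[𝕜] ξ.fiber x →L[𝕜] a.fiber y) {K : ℝ} (hK : 0 ≤ K)
    (hB : ∀ y x, ‖B y x‖ ≤ K) (x : X) (y : Y) (m : M.fiber (x, y)) (v : ξ.fiber x) :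
    fiberMap (convLift B hK hB) y (convElem M ξ x y m v) = B y x m v :=
  TensorSum.lift_elem (E := fun x => M.fiber (x, y)) (F := fun x => ξ.fiber x) (B y) K (hB y) x m v

/-- Functoriality of the product in the bundle. -/
def convMap (M : Bundle 𝕜 (X × Y)) {ξ ζ : Bundle 𝕜 X} (f : ξ ⟶ ζ) : conv M ξ ⟶ conv M ζ :=
  convLift (fun y x => ((convElem M ζ x y).flip.comp (fiberMap f x)).flip) (norm_nonneg f)
    fun y x => ContinuousLinearMap.opNorm_le_bound₂ _ (norm_nonneg f) fun m v =>
      (norm_convElem_le M ζ x y m _).trans <| by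
        rw [mul_right_comm, mul_comm]
        exact mul_le_mul_of_nonneg_right ((fiberMap f x).le_of_opNorm_le (norm_fiberMap_le f x) v)
          (norm_nonneg m)

@[simp] theorem convMap_convElem (M : Bundle 𝕜 (X × Y)) {ξ ζ : Bundle 𝕜 X} (f : ξ ⟶ ζ) (x : X)
    (y : Y) (m : M.fiber (x, y)) (v : ξ.fiber x) :
    fiberMap (convMap M f) y (convElem M ξ x y m v) = convElem M ζ x y m (fiberMap f x v) := by
  simp [convMap]

/-- Multiplication by a matrix, as a contractive functor. -/
def convFunctor (M : Bundle 𝕜 (X × Y)) : ContractiveFunctor 𝕜 (Bundle 𝕜 X) (Bundle 𝕜 Y) where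
  obj := conv M
  map := convMap M
  map_id ξ := conv_hom_ext fun x y m v => by simp
  map_comp f g := conv_hom_ext fun x y m v => by simp
  map_add f g := conv_hom_ext fun x y m v => by simp
  map_smul r f := conv_hom_ext fun x y m v => by simp
  norm_map_le f := norm_convLift_le _ _ _

/-! ### The adjunction between multiplication by `M` and `convHom M` -/

/-- The right adjoint of multiplication by `M`: the fibre over `x` is the `ℓ^∞`-product over `y` of
the spaces of bounded linear maps `M (x, y) → a y`. -/
def convHom (M : Bundle 𝕜 (X × Y)) (a : Bundle 𝕜 Y) : Bundle 𝕜 X where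
  fiber x := { carrier := lp (fun y => M.fiber (x, y) →L[𝕜] a.fiber y) ∞ }

/-- Evaluation of an element of a fibre of `convHom M a`. -/
def convHomEval (M : Bundle 𝕜 (X × Y)) (a : Bundle 𝕜 Y) (x : X) (y : Y) :
    (convHom M a).fiber x →L[𝕜] M.fiber (x, y) →L[𝕜] a.fiber y :=
  LinearMap.mkContinuous
    { toFun := fun t : lp (fun y => M.fiber (x, y) →L[𝕜] a.fiber y) ∞ => t y
      map_add' := fun _ _ => rfl
      map_smul' := fun _ _ => rfl } 1
    fun t => (lp.norm_apply_le_norm ENNReal.top_ne_zero t y).trans_eq (one_mul _).symm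

theorem norm_convHomEval_le (M : Bundle 𝕜 (X × Y)) (a : Bundle 𝕜 Y) (x : X) (y : Y) :
    ‖convHomEval M a x y‖ ≤ 1 := by
  unfold convHomEval
  exact LinearMap.mkContinuous_norm_le _ zero_le_one _

theorem convHom_ext {M : Bundle 𝕜 (X × Y)} {a : Bundle 𝕜 Y} {x : X} {s t : (convHom M a).fiber x}
    (h : ∀ y m, convHomEval M a x y s m = convHomEval M a x y t m) : s = t :=
  lp.ext (E := fun y => M.fiber (x, y) →L[𝕜] a.fiber y)
    (funext fun y => ContinuousLinearMap.ext (h y))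

theorem norm_convHom_le {M : Bundle 𝕜 (X × Y)} {a : Bundle 𝕜 Y} {x : X}
    {t : (convHom M a).fiber x} {K : ℝ} (hK : 0 ≤ K) (h : ∀ y, ‖convHomEval M a x y t‖ ≤ K) :
    ‖t‖ ≤ K :=
  lp.norm_le_of_forall_le (E := fun y => M.fiber (x, y) →L[𝕜] a.fiber y) hK h

theorem norm_fiberMap_comp_convElem_le {M : Bundle 𝕜 (X × Y)} {ξ : Bundle 𝕜 X} {a : Bundle 𝕜 Y}
    (h : conv M ξ ⟶ a) (x : X) (y : Y) (v : ξ.fiber x) :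
    ‖(fiberMap h y).comp ((convElem M ξ x y).flip v)‖ ≤ ‖h‖ * ‖v‖ :=
  ContinuousLinearMap.opNorm_le_bound _ (by positivity) fun m =>
    ((fiberMap h y).le_of_opNorm_le (norm_fiberMap_le h y) _).trans <| by
      rw [mul_assoc, mul_comm ‖v‖]
      exact mul_le_mul_of_nonneg_left (norm_convElem_le M ξ x y m v) (norm_nonneg h)

/-- The transpose of a morphism out of a product, at one fibre. -/
def curryFiber {M : Bundle 𝕜 (X × Y)} {ξ : Bundle 𝕜 X} {a : Bundle 𝕜 Y}
    (h : conv M ξ ⟶ a) (x : X) : ξ.fiber x →L[𝕜] (convHom M a).fiber x :=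
  LinearMap.mkContinuous
    { toFun := fun v => (⟨fun y => (fiberMap h y).comp ((convElem M ξ x y).flip v),
        memℓp_infty ⟨‖h‖ * ‖v‖, by
          rintro _ ⟨y, rfl⟩
          exact norm_fiberMap_comp_convElem_le h x y v⟩⟩ :
            lp (fun y => M.fiber (x, y) →L[𝕜] a.fiber y) ∞)
      map_add' := fun v w => convHom_ext (M := M) (a := a) fun y m => by
        change fiberMap h y (convElem M ξ x y m (v + w)) =
          fiberMap h y (convElem M ξ x y m v) + fiberMap h y (convElem M ξ x y m w)
        simp
      map_smul' := fun r v => convHom_ext (M := M) (a := a) fun y m => by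
        change fiberMap h y (convElem M ξ x y m (r • v)) =
          r • fiberMap h y (convElem M ξ x y m v)
        simp } ‖h‖
    fun v => norm_convHom_le (by positivity) fun y => norm_fiberMap_comp_convElem_le h x y v

theorem norm_curryFiber_le {M : Bundle 𝕜 (X × Y)} {ξ : Bundle 𝕜 X} {a : Bundle 𝕜 Y}
    (h : conv M ξ ⟶ a) (x : X) : ‖curryFiber h x‖ ≤ ‖h‖ := by
  unfold curryFiber
  exact LinearMap.mkContinuous_norm_le _ (norm_nonneg h) _

@[simp] theorem convHomEval_curryFiber {M : Bundle 𝕜 (X × Y)} {ξ : Bundle 𝕜 X} {a : Bundle 𝕜 Y}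
    (h : conv M ξ ⟶ a) (x : X) (y : Y) (v : ξ.fiber x) (m : M.fiber (x, y)) :
    convHomEval M a x y (curryFiber h x v) m = fiberMap h y (convElem M ξ x y m v) := rfl

theorem hom_convHom_ext {M : Bundle 𝕜 (X × Y)} {ξ : Bundle 𝕜 X} {a : Bundle 𝕜 Y}
    {f g : ξ ⟶ convHom M a}
    (h : ∀ x y v m, convHomEval M a x y (fiberMap f x v) m =
      convHomEval M a x y (fiberMap g x v) m) : f = g :=
  hom_ext fun x => ContinuousLinearMap.ext fun v => convHom_ext fun y m => h x y v m

/-- The transpose of a morphism out of a product. -/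
def curry (M : Bundle 𝕜 (X × Y)) (ξ : Bundle 𝕜 X) (a : Bundle 𝕜 Y) :
    (conv M ξ ⟶ a) →L[𝕜] (ξ ⟶ convHom M a) :=
  LinearMap.mkContinuous
    { toFun := fun h => mkHom (ζ := convHom M a) (curryFiber h) ‖h‖ (norm_curryFiber_le h)
      map_add' := fun h h' => hom_convHom_ext fun x y v m => by simp
      map_smul' := fun r h => hom_convHom_ext fun x y v m => by simp } 1
    fun h => by
      rw [one_mul]
      exact norm_le_of_fiberMap _ (norm_nonneg h) (norm_curryFiber_le h)

theorem norm_curry_le (M : Bundle 𝕜 (X × Y)) (ξ : Bundle 𝕜 X) (a : Bundle 𝕜 Y) :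
    ‖curry M ξ a‖ ≤ 1 := by
  unfold curry
  exact LinearMap.mkContinuous_norm_le _ zero_le_one _

@[simp] theorem convHomEval_curry {M : Bundle 𝕜 (X × Y)} {ξ : Bundle 𝕜 X} {a : Bundle 𝕜 Y}
    (h : conv M ξ ⟶ a) (x : X) (y : Y) (v : ξ.fiber x) (m : M.fiber (x, y)) :
    convHomEval M a x y (fiberMap (curry M ξ a h) x v) m =
      fiberMap h y (convElem M ξ x y m v) := rfl

theorem norm_uncurry_aux {M : Bundle 𝕜 (X × Y)} {ξ : Bundle 𝕜 X} {a : Bundle 𝕜 Y}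
    (g : ξ ⟶ convHom M a) (y : Y) (x : X) :
    ‖((convHomEval M a x y).comp (fiberMap g x)).flip‖ ≤ ‖g‖ := by
  rw [ContinuousLinearMap.opNorm_flip]
  refine (ContinuousLinearMap.opNorm_comp_le _ _).trans ?_
  simpa using mul_le_mul (norm_convHomEval_le M a x y) (norm_fiberMap_le g x) (norm_nonneg _)
    zero_le_one

/-- The inverse of transposition. -/
def uncurry {M : Bundle 𝕜 (X × Y)} {ξ : Bundle 𝕜 X} {a : Bundle 𝕜 Y} (g : ξ ⟶ convHom M a) :
    conv M ξ ⟶ a :=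
  convLift (fun y x => ((convHomEval M a x y).comp (fiberMap g x)).flip) (norm_nonneg g)
    (norm_uncurry_aux g)

theorem norm_uncurry_le {M : Bundle 𝕜 (X × Y)} {ξ : Bundle 𝕜 X} {a : Bundle 𝕜 Y}
    (g : ξ ⟶ convHom M a) : ‖uncurry g‖ ≤ ‖g‖ :=
  norm_convLift_le _ _ _

theorem uncurry_convElem {M : Bundle 𝕜 (X × Y)} {ξ : Bundle 𝕜 X} {a : Bundle 𝕜 Y}
    (g : ξ ⟶ convHom M a) (x : X) (y : Y) (m : M.fiber (x, y)) (v : ξ.fiber x) :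
    fiberMap (uncurry g) y (convElem M ξ x y m v) = convHomEval M a x y (fiberMap g x v) m := by
  simp [uncurry]

theorem uncurry_curry {M : Bundle 𝕜 (X × Y)} {ξ : Bundle 𝕜 X} {a : Bundle 𝕜 Y}
    (h : conv M ξ ⟶ a) : uncurry (curry M ξ a h) = h :=
  conv_hom_ext fun x y m v => by rw [uncurry_convElem, convHomEval_curry]

/-- Naturality of transposition in the bundle variable; this is what turns cylinders into cylinders.
-/
theorem curry_convMap_comp {M : Bundle 𝕜 (X × Y)} {ξ ζ : Bundle 𝕜 X} {a : Bundle 𝕜 Y}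
    (f : ξ ⟶ ζ) (h : conv M ζ ⟶ a) :
    curry M ξ a (convMap M f ≫ h) = f ≫ curry M ζ a h :=
  hom_convHom_ext fun x y v m => by simp

theorem convMap_comp_uncurry {M : Bundle 𝕜 (X × Y)} {ξ ζ : Bundle 𝕜 X} {a : Bundle 𝕜 Y}
    (f : ξ ⟶ ζ) (g : ζ ⟶ convHom M a) : convMap M f ≫ uncurry g = uncurry (f ≫ g) :=
  conv_hom_ext fun x y m v => by simp [uncurry_convElem]

/-- Left adjoints preserve weighted colimits. A cylinder from the image diagram to `a` transposes to
a cylinder from the original diagram to `convHom M a`, and the morphism that it induces out of `c`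
transposes back. Both transpositions are contractions, so the same bound `K` survives. -/
theorem convFunctor_isCocontinuous (M : Bundle 𝕜 (X × Y)) : (convFunctor M).IsCocontinuous := by
  intro J _ _ W D c l hl
  refine ⟨fun j => ?_, fun a m K hK hm => ?_⟩
  · refine (ContinuousLinearMap.opNorm_comp_le _ _).trans ?_
    simpa using mul_le_mul ((convFunctor M).norm_mapCLM_le (D.obj j) c) (hl.1 j) (norm_nonneg _)
      zero_le_one
  · obtain ⟨h, hn, hh, hu⟩ := hl.2 (convHom M a)
      { app := fun j => (curry M (D.obj j) a).comp (m.app j)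
        naturality := fun {i j} f s => by
          change curry M _ a (m.app i (W.map f s)) = D.map f ≫ curry M _ a (m.app j s)
          rw [m.naturality]
          exact curry_convMap_comp _ _ } K hK fun j =>
        (ContinuousLinearMap.opNorm_comp_le _ _).trans <|
          (mul_le_mul (norm_curry_le M (D.obj j) a) (hm j) (norm_nonneg _) zero_le_one).trans_eq
            (one_mul K)
    refine ⟨uncurry h, (norm_uncurry_le h).trans hn, fun j s => ?_, fun h' hh' => ?_⟩
    · change convMap M (l.app j s) ≫ uncurry h = m.app j s
      rw [convMap_comp_uncurry, hh]
      exact uncurry_curry _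
    -- The transpose of `h'` solves the transposed problem, so it equals `h`.
    · change conv M c ⟶ a at h'
      rw [← hu (curry M c a h') fun j s => ?_, uncurry_curry]
      rw [← curry_convMap_comp]
      exact congrArg (curry M (D.obj j) a) (hh' j s)

/-- The cocontinuous functor of a matrix. -/
def convCocont (M : Bundle 𝕜 (X × Y)) : CocontFunctor 𝕜 (Bundle 𝕜 X) (Bundle 𝕜 Y) where
  toContractiveFunctor := convFunctor M
  cocontinuous := convFunctor_isCocontinuous M

end

end Bundle

/-! ## The isomorphism `∑ₓ T_x ⊗ ξ_x ≅ T ξ` -/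

namespace Bundle

section
variable {𝕜 : Type u} [RCLike 𝕜] {X Y Z : Type u}

/-- The component of a morphism at a point, as a bounded linear map. -/
def fiberMapCLM (a b : Bundle 𝕜 X) (x : X) : (a ⟶ b) →L[𝕜] (a.fiber x →L[𝕜] b.fiber x) :=
  LinearMap.mkContinuous
    { toFun := fun f => fiberMap f x
      map_add' := fun _ _ => rfl
      map_smul' := fun _ _ => rfl } 1
    fun f => (norm_fiberMap_le f x).trans_eq (one_mul _).symm

/-- The canonical morphism `∑ₓ T_x ⊗ ξ_x ⟶ T ξ`. -/
def assembly (T : CocontFunctor 𝕜 (Bundle 𝕜 X) (Bundle 𝕜 Y)) (ξ : Bundle 𝕜 X) :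
    conv (matrixObj T) ξ ⟶ T.obj ξ :=
  convLift (M := matrixObj T) (fun y x => ((fiberMapCLM (T.obj (delta 𝕜 x)) (T.obj ξ) y).comp
      ((T.mapCLM (delta 𝕜 x) ξ).comp (pointCLM ξ x))).flip) zero_le_one fun y _ =>
    (ContinuousLinearMap.opNorm_flip _).trans_le <|
      ContinuousLinearMap.opNorm_le_bound _ zero_le_one fun v => le_of_le_of_eq (b := ‖v‖)
        ((norm_fiberMap_le (T.map (point v)) y).trans ((T.norm_map_le _).trans (norm_point_le v)))
        (one_mul _).symm

@[simp] theorem assembly_convElem (T : CocontFunctor 𝕜 (Bundle 𝕜 X) (Bundle 𝕜 Y)) (ξ : Bundle 𝕜 X)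
    (x : X) (y : Y) (m : (T.obj (delta 𝕜 x)).fiber y) (v : ξ.fiber x) :
    fiberMap (assembly T ξ) y (convElem (matrixObj T) ξ x y m v) =
      fiberMap (T.map (point v)) y m :=
  convLift_convElem (M := matrixObj T) _ _ _ x y m v

theorem norm_assembly_le (T : CocontFunctor 𝕜 (Bundle 𝕜 X) (Bundle 𝕜 Y)) (ξ : Bundle 𝕜 X) :
    ‖assembly T ξ‖ ≤ 1 :=
  norm_convLift_le _ _ _

/-- The inclusion `T_x ⟶ ∑ₓ T_x ⊗ ξ_x` determined by an element of `ξ_x`. -/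
def insertion (T : CocontFunctor 𝕜 (Bundle 𝕜 X) (Bundle 𝕜 Y)) (ξ : Bundle 𝕜 X) (x : X) :
    ξ.fiber x →L[𝕜] (T.obj (delta 𝕜 x) ⟶ conv (matrixObj T) ξ) :=
  have hb : ∀ (v : ξ.fiber x) (y : Y), ‖(convElem (matrixObj T) ξ x y).flip v‖ ≤ ‖v‖ :=
    fun v y => ContinuousLinearMap.opNorm_le_bound _ (norm_nonneg v) fun m =>
      (norm_convElem_le (matrixObj T) ξ x y m v).trans_eq (mul_comm _ _)
  LinearMap.mkContinuous
    { toFun := fun v => mkHom (ξ := T.obj (delta 𝕜 x))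
        (fun y => (convElem (matrixObj T) ξ x y).flip v) ‖v‖ (hb v)
      map_add' := fun v w => hom_ext fun _ => map_add _ v w
      map_smul' := fun r v => hom_ext fun _ => map_smul _ r v } 1
    fun v => (norm_le_of_fiberMap _ (norm_nonneg v) (hb v)).trans_eq (one_mul _).symm

theorem norm_insertion_le (T : CocontFunctor 𝕜 (Bundle 𝕜 X) (Bundle 𝕜 Y)) (ξ : Bundle 𝕜 X)
    (x : X) : ‖insertion T ξ x‖ ≤ 1 := by
  unfold insertion
  exact LinearMap.mkContinuous_norm_le _ zero_le_one _

theorem fiberMap_insertion (T : CocontFunctor 𝕜 (Bundle 𝕜 X) (Bundle 𝕜 Y)) (ξ : Bundle 𝕜 X)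
    (x : X) (y : Y) (v : ξ.fiber x) (m : (T.obj (delta 𝕜 x)).fiber y) :
    fiberMap (insertion T ξ x v) y m = convElem (matrixObj T) ξ x y m v := rfl

/-- The universal property of `T ξ`, applied to the insertions `v ↦ (m ↦ m ⊗ v)`, yields a
contraction in the other direction. One composite is checked on elementary tensors, the other on the
jointly epic morphisms `T (point v)`. As `assembly` is also a contraction, the isomorphism is
isometric. -/
theorem exists_assembly_inverse (T : CocontFunctor 𝕜 (Bundle 𝕜 X) (Bundle 𝕜 Y)) (ξ : Bundle 𝕜 X) :
    ∃ h : T.obj ξ ⟶ conv (matrixObj T) ξ, ‖h‖ ≤ 1 ∧ assembly T ξ ≫ h = 𝟙 _ ∧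
      h ≫ assembly T ξ = 𝟙 _ := by
  obtain ⟨h, hn, hh, -⟩ := T.exists_desc (insertion T ξ) zero_le_one (norm_insertion_le T ξ)
  refine ⟨h, hn, conv_hom_ext fun x y m v => ?_, T.hom_ext fun x v => hom_ext fun y =>
    ContinuousLinearMap.ext fun m => ?_⟩
  · exact (congrArg (fiberMap h y) (assembly_convElem T ξ x y m v)).trans
      (congrArg (fun f => fiberMap f y m) (hh x v))
  · rw [← Category.assoc, hh, Category.comp_id, fiberMap_comp, ContinuousLinearMap.comp_apply,
      fiberMap_insertion, assembly_convElem]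

/-- The fibres of isometrically isomorphic bundles are isometrically isomorphic. -/
def fiberEquiv {a b : Bundle 𝕜 X} (f : a ⟶ b) (g : b ⟶ a) (hf : ‖f‖ ≤ 1) (hg : ‖g‖ ≤ 1)
    (hfg : f ≫ g = 𝟙 a) (hgf : g ≫ f = 𝟙 b) (x : X) : a.fiber x ≃ₗᵢ[𝕜] b.fiber x :=
  have hl : ∀ v, fiberMap g x (fiberMap f x v) = v := fun v =>
    congrArg (fun k => fiberMap k x v) hfg
  have hr : ∀ v, fiberMap f x (fiberMap g x v) = v := fun v =>
    congrArg (fun k => fiberMap k x v) hgf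
  have hbf : ∀ v, ‖fiberMap f x v‖ ≤ ‖v‖ := fun v => by
    simpa using (fiberMap f x).le_of_opNorm_le ((norm_fiberMap_le f x).trans hf) v
  have hbg : ∀ v, ‖fiberMap g x v‖ ≤ ‖v‖ := fun v => by
    simpa using (fiberMap g x).le_of_opNorm_le ((norm_fiberMap_le g x).trans hg) v
  { toFun := fiberMap f x
    invFun := fiberMap g x
    map_add' := map_add _
    map_smul' := map_smul _
    left_inv := hl
    right_inv := hr
    norm_map' := fun v => le_antisymm (hbf v) ((congrArg norm (hl v)).symm.trans_le (hbg _)) }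

/-- The isometric isomorphism `∑ₓ T_x^y ⊗ ξ_x ≅ (T ξ)_y`. -/
def assemblyEquiv (T : CocontFunctor 𝕜 (Bundle 𝕜 X) (Bundle 𝕜 Y)) (ξ : Bundle 𝕜 X) (y : Y) :
    (conv (matrixObj T) ξ).fiber y ≃ₗᵢ[𝕜] (T.obj ξ).fiber y :=
  have h := (exists_assembly_inverse T ξ).choose_spec
  fiberEquiv (assembly T ξ) (exists_assembly_inverse T ξ).choose (norm_assembly_le T ξ) h.1 h.2.1
    h.2.2 y

/-- Only the inverse of `assemblyEquiv` comes from a choice; its forward map is the explicit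
`assembly`. This formula on elementary tensors is what the naturality statement of part (2) rests
on. -/
theorem assemblyEquiv_convElem (T : CocontFunctor 𝕜 (Bundle 𝕜 X) (Bundle 𝕜 Y)) (ξ : Bundle 𝕜 X)
    (x : X) (y : Y) (m : (T.obj (delta 𝕜 x)).fiber y) (v : ξ.fiber x) :
    assemblyEquiv T ξ y (convElem (matrixObj T) ξ x y m v) = fiberMap (T.map (point v)) y m :=
  assembly_convElem T ξ x y m v

/-! ## The functor `T ↦ T_x^y` is an equivalence -/

/-- The bundle `M (x, -)`. -/
def row (M : Bundle 𝕜 (X × Y)) (x : X) : Bundle 𝕜 Y where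
  fiber y := M.fiber (x, y)

open Classical in
/-- The identity of `E x` if `y = x`, and `0` otherwise. -/
def singleCLM {E : X → Type u} [∀ x, NormedAddCommGroup (E x)] [∀ x, NormedSpace 𝕜 (E x)]
    (x y : X) : E x →L[𝕜] E y :=
  LinearMap.mkContinuous
    { toFun := fun v => Pi.single (M := E) x v y
      map_add' := fun v w => by rw [Pi.single_add, Pi.add_apply]
      map_smul' := fun r v => by rw [Pi.single_smul, Pi.smul_apply, RingHom.id_apply] } 1
    fun v => (norm_piSingle_le x y v).trans_eq (one_mul _).symm

theorem singleCLM_self {E : X → Type u} [∀ x, NormedAddCommGroup (E x)]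
    [∀ x, NormedSpace 𝕜 (E x)] (x : X) (v : E x) : singleCLM (𝕜 := 𝕜) (E := E) x x v = v := by
  classical
  exact Pi.single_eq_same (M := E) x v

theorem norm_singleCLM_apply_le {E : X → Type u} [∀ x, NormedAddCommGroup (E x)]
    [∀ x, NormedSpace 𝕜 (E x)] (x y : X) (v : E x) :
    ‖singleCLM (𝕜 := 𝕜) (E := E) x y v‖ ≤ ‖v‖ :=
  norm_piSingle_le x y v

/-- The canonical morphism from the image of `δ_x` under multiplication by `M` to the row of `M`
at `x`. -/
def convDelta (M : Bundle 𝕜 (X × Y)) (x : X) : conv M (delta 𝕜 x) ⟶ row M x :=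
  -- On the summand `x'`, the tensor `m ⊗ c` goes to `c • m` if `x' = x` and to `0` otherwise.
  convLift (a := row M x) (fun y x' => (ContinuousLinearMap.lsmul 𝕜 𝕜).flip.bilinearComp
      (singleCLM (E := fun x => M.fiber (x, y)) x' x) (deltaVal 𝕜 x x')) zero_le_one fun y x' =>
    ContinuousLinearMap.opNorm_le_bound₂ _ zero_le_one fun m c => by
      change ‖deltaVal 𝕜 x x' c • singleCLM (𝕜 := 𝕜) (E := fun x => M.fiber (x, y)) x' x m‖ ≤ _
      rw [norm_smul, norm_deltaVal_apply, one_mul, mul_comm]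
      exact mul_le_mul_of_nonneg_right (norm_singleCLM_apply_le (E := fun x => M.fiber (x, y)) _ _ m)
        (norm_nonneg c)

theorem convDelta_convElem (M : Bundle 𝕜 (X × Y)) (x : X) (y : Y) (m : M.fiber (x, y)) :
    fiberMap (convDelta M x) y (convElem M (delta 𝕜 x) x y m (deltaOne 𝕜 x)) = m := by
  refine (convLift_convElem (a := row M x) _ _ _ x y m _).trans ?_
  change deltaVal 𝕜 x x (deltaOne 𝕜 x) • singleCLM (𝕜 := 𝕜) (E := fun x => M.fiber (x, y)) x x m = m
  rw [deltaVal_deltaOne, one_smul]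
  exact singleCLM_self (E := fun x => M.fiber (x, y)) x m

theorem norm_convElem_deltaOne_le (M : Bundle 𝕜 (X × Y)) (x : X) (y : Y) :
    ‖(convElem M (delta 𝕜 x) x y).flip (deltaOne 𝕜 x)‖ ≤ 1 :=
  ContinuousLinearMap.opNorm_le_bound _ zero_le_one fun m =>
    (norm_convElem_le M (delta 𝕜 x) x y m _).trans_eq (by rw [norm_deltaOne, mul_comm])

/-- A summand `x' ≠ x` has zero second factor, and in the summand `x` one has `m ⊗ c = (c • m) ⊗ 1`.
-/
theorem convElem_convDelta (M : Bundle 𝕜 (X × Y)) (x : X) (y : Y)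
    (t : (conv M (delta 𝕜 x)).fiber y) :
    convElem M (delta 𝕜 x) x y (fiberMap (convDelta M x) y t) (deltaOne 𝕜 x) = t := by
  -- Stated as an equality of morphisms, the claim for arbitrary `t` reduces to elementary tensors.
  have h : convDelta M x ≫ mkHom (ξ := row M x)
      (fun y => (convElem M (delta 𝕜 x) x y).flip (deltaOne 𝕜 x)) 1
      (norm_convElem_deltaOne_le M x) = 𝟙 _ := by
    refine conv_hom_ext fun x' y m c => ?_
    by_cases h : x' = x
    · subst h
      rw [delta_fiber_self x' c, map_smul, map_smul, map_smul]
      exact congrArg (fun m => deltaVal 𝕜 x' x' c • convElem M (delta 𝕜 x') x' y m (deltaOne 𝕜 x'))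
        (convDelta_convElem M x' y m)
    · rw [delta_fiber_of_ne h c, map_zero, map_zero, map_zero]
  exact congrArg (fun f => fiberMap f y t) h

/-- The matrix of the cocontinuous functor of `M` is `M`. -/
def matrixConvIso (M : Bundle 𝕜 (X × Y)) : matrixObj (convCocont M) ≅ M where
  hom := mkHom (ξ := matrixObj (convCocont M)) (fun p => fiberMap (convDelta M p.1) p.2) 1
    fun _ => (norm_fiberMap_le _ _).trans (norm_convLift_le _ _ _)
  inv := mkHom (ζ := matrixObj (convCocont M))
    (fun p => (convElem M (delta 𝕜 p.1) p.1 p.2).flip (deltaOne 𝕜 p.1)) 1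
    fun p => norm_convElem_deltaOne_le M p.1 p.2
  hom_inv_id := hom_ext fun p => ContinuousLinearMap.ext fun t => convElem_convDelta M p.1 p.2 t
  inv_hom_id := hom_ext fun p => ContinuousLinearMap.ext fun m => convDelta_convElem M p.1 p.2 m

theorem point_deltaOne_eq_id (x : X) : point (deltaOne 𝕜 x) = 𝟙 (delta 𝕜 x) :=
  delta_hom_ext (by simp)

/-- Naturality along `point v : δ_x ⟶ ξ` expresses `T (point v) ≫ σ_ξ` through `σ_{δ_x}`, and the `T
(point v)` are jointly epic. -/
theorem matrix_faithful {T T' : CocontFunctor 𝕜 (Bundle 𝕜 X) (Bundle 𝕜 Y)} {σ τ : T ⟶ T'}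
    (h : matrixMap σ = matrixMap τ) : σ = τ := by
  refine CocontFunctor.natTrans_ext fun ξ => T.hom_ext fun x v => ?_
  have h' : CocontFunctor.app σ (delta 𝕜 x) = CocontFunctor.app τ (delta 𝕜 x) :=
    hom_ext fun y => congrArg (fun f => fiberMap f (x, y)) h
  exact (CocontFunctor.app_naturality σ (point v)).trans
    ((congrArg (· ≫ T'.map (point v)) h').trans (CocontFunctor.app_naturality τ (point v)).symm)

/-- The slices `g (x, -)` are prescribed components `T δ_x ⟶ T' δ_x`. At a general `ξ` the universal
property of `T ξ` supplies the only component compatible with all `point v`, with norm still at most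
`‖g‖`. As `matrix` is contractive, this makes it isometric on hom-spaces. -/
theorem matrix_full {T T' : CocontFunctor 𝕜 (Bundle 𝕜 X) (Bundle 𝕜 Y)}
    (g : matrixObj T ⟶ matrixObj T') : ∃ τ : T ⟶ T', matrixMap τ = g ∧ ‖τ‖ ≤ ‖g‖ := by
  have hb : ∀ x y, ‖fiberMap g (x, y)‖ ≤ ‖g‖ := fun x y => norm_fiberMap_le g (x, y)
  let G : ∀ x, T.obj (delta 𝕜 x) ⟶ T'.obj (delta 𝕜 x) := fun x =>
    mkHom (ξ := T.obj (delta 𝕜 x)) (ζ := T'.obj (delta 𝕜 x)) (fun y => fiberMap g (x, y)) ‖g‖ (hb x)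
  have hG : ∀ x, ‖G x‖ ≤ ‖g‖ := fun x => norm_le_of_fiberMap _ (norm_nonneg g) (hb x)
  have key : ∀ ξ : Bundle 𝕜 X, ∃ h : T.obj ξ ⟶ T'.obj ξ, ‖h‖ ≤ ‖g‖ ∧
      ∀ x (v : ξ.fiber x), T.map (point v) ≫ h = G x ≫ T'.map (point v) := fun ξ => by
    obtain ⟨h, h1, h2, -⟩ := T.exists_desc (fun x => (precompCLM (G x) (T'.obj ξ)).comp
      ((T'.mapCLM (delta 𝕜 x) ξ).comp (pointCLM ξ x))) (norm_nonneg g) fun x =>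
        ContinuousLinearMap.opNorm_le_bound _ (norm_nonneg g) fun v =>
          ContractiveFunctor.norm_comp_le_of_le (hG x)
            ((T'.norm_map_le (point v)).trans (norm_point_le v))
    exact ⟨h, h1, h2⟩
  choose t ht htp using key
  let τ : T.toContractiveFunctor.natTrans T'.toContractiveFunctor :=
    ⟨⟨t, memℓp_infty ⟨‖g‖, by rintro _ ⟨ξ, rfl⟩; exact ht ξ⟩⟩, fun ξ ζ f =>
      -- Naturality along `f` is tested on the points of `ξ`, since `point v ≫ f` is again a point,
      -- namely that of `f v`.
      T.hom_ext fun x v => by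
        change T.map (point v) ≫ T.map f ≫ t ζ = T.map (point v) ≫ t ξ ≫ T'.map f
        rw [← Category.assoc, ← T.map_comp, point_comp, htp, ← Category.assoc, htp,
          Category.assoc, ← T'.map_comp, point_comp]⟩
  refine ⟨τ, hom_ext fun p => ?_, lp.norm_le_of_forall_le (norm_nonneg g) ht⟩
  -- The point of the generator is the identity of `δ_x`, so the defining equation at `ξ = δ_x` says
  -- that the constructed component is the prescribed one.
  have h := htp (delta 𝕜 p.1) p.1 (deltaOne 𝕜 p.1)
  rw [point_deltaOne_eq_id, T.map_id, T'.map_id, Category.id_comp, Category.comp_id] at h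
  exact congrArg (fun f => fiberMap f p.2) h

theorem matrix_isBanachEquivalence (𝕜 : Type u) [RCLike 𝕜] (X Y : Type u) :
    (matrix 𝕜 X Y).IsBanachEquivalence :=
  .of_fullyFaithful _ (fun _ _ g => matrix_full g) (fun _ _ _ _ h => matrix_faithful h)
    fun M => ⟨convCocont M, matrixConvIso M,
      norm_le_of_fiberMap _ zero_le_one fun p =>
        (norm_fiberMap_le (convDelta M p.1) p.2).trans (norm_convLift_le _ _ _),
      norm_le_of_fiberMap _ zero_le_one fun p => norm_convElem_deltaOne_le M p.1 p.2⟩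

end

end Bundle

end

theorem mainTheorem9 (𝕜 : Type u) [RCLike 𝕜] :
    (∀ X Y : Type u, (Bundle.matrix 𝕜 X Y).IsBanachEquivalence) ∧
    (∀ X Y Z : Type u,
      ∃ θ : ∀ (S : CocontFunctor 𝕜 (Bundle 𝕜 Y) (Bundle 𝕜 Z))
          (T : CocontFunctor 𝕜 (Bundle 𝕜 X) (Bundle 𝕜 Y)) (x : X) (z : Z),
          (Bundle.matMul (Bundle.matrixObj S) (Bundle.matrixObj T)).fiber (x, z)
            ≃ₗᵢ[𝕜] (Bundle.matrixObj (CocontFunctor.compose S T)).fiber (x, z),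
        ∀ (S S' : CocontFunctor 𝕜 (Bundle 𝕜 Y) (Bundle 𝕜 Z))
          (T T' : CocontFunctor 𝕜 (Bundle 𝕜 X) (Bundle 𝕜 Y)) (σ : S ⟶ S') (τ : T ⟶ T')
          (x : X) (y : Y) (z : Z)
          (s : (Bundle.matrixObj S).fiber (y, z)) (t : (Bundle.matrixObj T).fiber (x, y)),
          Bundle.fiberMap (Bundle.matrixMap (CocontFunctor.hcomp σ τ)) (x, z)
              (θ S T x z (Bundle.elemTensor _ _ x y z s t)) =
            θ S' T' x z (Bundle.elemTensor _ _ x y z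
              (Bundle.fiberMap (Bundle.matrixMap σ) (y, z) s)
              (Bundle.fiberMap (Bundle.matrixMap τ) (x, y) t))) := by
  refine ⟨Bundle.matrix_isBanachEquivalence 𝕜, fun X Y Z =>
    -- By definition `(ST)_x^z` is the fibre over `z` of `S (T δ_x)`, and the matrix product at `(x,
    -- z)` is the fibre of `conv (matrixObj S) (T δ_x)`. Naturality on elementary tensors is full
    -- naturality, since they determine bounded linear maps on the sum (`TensorSum.hom_ext`).
    ⟨fun S T x z => Bundle.assemblyEquiv S (T.obj (Bundle.delta 𝕜 x)) z,
      fun S S' T T' σ τ x y z s t => ?_⟩⟩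
  change (T.obj (Bundle.delta 𝕜 x)).fiber y at t
  -- Since `θ (s ⊗ t) = S (point t)_z s`, the naturality square amounts to this identity evaluated
  -- at `s`. It combines naturality of `point` along `τ_{δ_x}` with naturality of `σ` along the
  -- resulting point.
  have h : S.map (Bundle.point t) ≫ S.map (CocontFunctor.app τ (Bundle.delta 𝕜 x)) ≫
      CocontFunctor.app σ (T'.obj (Bundle.delta 𝕜 x)) =
      CocontFunctor.app σ (Bundle.delta 𝕜 y) ≫ S'.map (Bundle.point
        (Bundle.fiberMap (CocontFunctor.app τ (Bundle.delta 𝕜 x)) y t)) := by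
    rw [← Category.assoc, ← S.map_comp, Bundle.point_comp, CocontFunctor.app_naturality]
  refine (congrArg (Bundle.fiberMap (Bundle.matrixMap (CocontFunctor.hcomp σ τ)) (x, z))
    (Bundle.assemblyEquiv_convElem S (T.obj (Bundle.delta 𝕜 x)) y z s t)).trans ?_
  refine Eq.trans ?_ (Bundle.assemblyEquiv_convElem S' (T'.obj (Bundle.delta 𝕜 x)) y z
    (Bundle.fiberMap (CocontFunctor.app σ (Bundle.delta 𝕜 y)) z s)
    (Bundle.fiberMap (CocontFunctor.app τ (Bundle.delta 𝕜 x)) y t)).symm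
  exact congrArg (fun f => Bundle.fiberMap f z s) h
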